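/- Let $\mathbb R_m$ be the real Clifford algebra with generators $e_1,\dots,e_m$, $e_je_k+e_ke_j=-2\delta_{jk}$, let $\mathbb C_m=\mathbb R_m\oplus i\,\mathbb R_m$, and let $c\mapsto c^\dagger$ be the Hermitian conjugation $(a+ib)^\dagger=\bar a-i\bar b$, where $a\mapsto\bar a$ is the anti-automorphism of $\mathbb R_m$ with $\bar e_j=-e_j$. Write $\underline z=\sum_j z_je_j$ and $z\cdot w=\sum_j z_jw_j$ for $z,w\in\mathbb C^m$. A $C^1$ function $g:\mathbb R^m\to\mathbb C_m$ is monogenic if $\sum_j e_j\partial_{x_j}g=0$; an entire function $F:\mathbb C^m\to\mathbb C_m$ is monogenic if $\sum_j e_j\partial_{z_j}F=0$. Every homogeneous polynomial $R_k:\mathbb C^m\to\mathbb C_m$ of degree $k$ is uniquely of the form $R_k(z)=M_k(z)+\underline z\,R_{k-1}(z)$ with $M_k$ a monogenic homogeneous polynomial of degree $k$ and $\underline z\,R_{k-1}$ the product of $\underline z$ with a homogeneous polynomial of degree $k-1$ (zero if $k=0$); put $\mathcal M(R_k)=M_k$. For an entire function $F=\sum_k R_k$, with $R_k$ homogeneous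 of degree $k$, its monogenic part is $\mathcal M(F)=\sum_k\mathcal M(R_k)$, when this series converges at every point. For $u\in\mathbb R^m$ let $E(\cdot,u)$ be the monogenic part of $z\mapsto e^{z\cdot u}$ (the Fourier–Borel kernel). For $f\in L^2(\mathbb R^m;\mathbb C_m)$ let $$\mathcal B[f](z)=\frac1{(2\pi)^{m/2}}\int_{\mathbb R^m}\exp\Big(-\frac{z\cdot z}2+x\cdot z-\frac{x\cdot x}4\Big)f(x)\,dx,\qquad z\in\mathbb C^m .$$ For real analytic $R,S:\mathbb R^m\to\mathbb C_m$, where $R$ has Taylor coefficients $r_\alpha=\partial^\alpha R(0)/\alpha!$ at the origin, the Fischer inner product is $[R,S]=R(\partial_x)^\dagger S(x)|_{x=0}=\sum_\alpha r_\alpha^\dagger\,\partial^\alpha S(0)$, when this series converges. **Proposition 4.6.** Let $g:\mathbb R^m\to\mathbb C_m$ be such that $f(x)=g(x)e^{-|x|^2/4}$ belongs to $L^2(\mathbb R^m;\mathbb C_m)$. Then $E(\cdot,u)$ is well defined for every $u\in\mathbb R^m$, $\mathcal B[f]$ is a well-defined entire function that has a monogenic part, and for every $z\in\mathbb C^m$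 $$\mathcal M\big(\mathcal B[f]\big)(z)=\frac1{(2\pi)^{m/2}}\int_{\mathbb R^m}E(z,x)\,g(x)\,e^{-|x|^2/2}\,dx ,$$ where the integrand is integrable. If $g$ is harmonic on $\mathbb R^m$, then $E(z,\cdot)^\dagger$ and $g$ are real analytic, and this expression also equals the Fischer inner product $[E(z,\cdot)^\dagger,g]$ (in particular, the latter exists) for every $z\in\mathbb C^m$. If $g$ is monogenic, then $g$ extends to an entire function on $\mathbb C^m$, again written $g$, and $\mathcal M(\mathcal B[f])(z)=g(z)$ for every $z\in\mathbb C^m$. -/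

import Mathlib

open scoped TensorProduct
open MeasureTheory

noncomputable section

/-- The negative definite form `x ↦ -(x₁² + ⋯ + x_m²)` on `ℝ^m`. -/
def cliffordForm (m : ℕ) : QuadraticForm ℝ (Fin m → ℝ) :=
  QuadraticMap.weightedSumSquares ℝ (fun _ : Fin m => (-1 : ℝ))

instance cliffordStarModule (m : ℕ) : StarModule ℝ (CliffordAlgebra (cliffordForm m)) where
  star_smul r x := by simp

/-- The complex Clifford algebra `ℂ_m = ℝ_m ⊕ i ℝ_m`, the complexification of the real Clifford
algebra `ℝ_m` with `e_j e_k + e_k e_j = -2 δ_{jk}`. -/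
def ComplexClifford (m : ℕ) : Type := ℂ ⊗[ℝ] CliffordAlgebra (cliffordForm m)

namespace ComplexClifford

variable (m : ℕ)

instance instRing : Ring (ComplexClifford m) :=
  inferInstanceAs (Ring (ℂ ⊗[ℝ] CliffordAlgebra (cliffordForm m)))

instance instAlgebra : Algebra ℂ (ComplexClifford m) :=
  inferInstanceAs (Algebra ℂ (ℂ ⊗[ℝ] CliffordAlgebra (cliffordForm m)))

/-- `star` is the Hermitian conjugation `c† = ā - i b̄` of `c = a + i b`: on pure tensors it is
`star (λ ⊗ a) = conj λ ⊗ ā`, where `a ↦ ā` is the anti-automorphism of `ℝ_m` with `ē_j = -e_j`. -/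
instance instStarRing : StarRing (ComplexClifford m) :=
  inferInstanceAs (StarRing (ℂ ⊗[ℝ] CliffordAlgebra (cliffordForm m)))

/-- The basis of `ℂ_m` indexed by the subsets `A` of `{1, …, m}`, obtained from the basis
`e_{j₁} ∧ ⋯ ∧ e_{j_k}` of the exterior algebra. -/
def basis : Module.Basis (Finset (Fin m)) ℂ (ComplexClifford m) :=
  (((Pi.basisFun ℝ (Fin m)).ExteriorAlgebra.map
    (CliffordAlgebra.equivExterior (cliffordForm m)).symm).baseChange ℂ)

/-- `ℂ_m` carries the norm `(∑_A |a_A|²)^{1/2}` of the coordinates. (`ℂ_m` is finite-dimensional,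
so integrals, derivatives, limits and square-integrability do not depend on the norm.) -/
def toEuclidean : ComplexClifford m →ₗ[ℂ] EuclideanSpace ℂ (Finset (Fin m)) :=
  (WithLp.linearEquiv 2 ℂ (Finset (Fin m) → ℂ)).symm.toLinearMap ∘ₗ
    (basis m).equivFun.toLinearMap

lemma toEuclidean_injective : Function.Injective (toEuclidean m) := by
  intro a b h
  simpa [toEuclidean] using h

instance instNormedAddCommGroup : NormedAddCommGroup (ComplexClifford m) :=
  NormedAddCommGroup.induced _ _ (toEuclidean m) (toEuclidean_injective m)

instance instNormedSpace : NormedSpace ℂ (ComplexClifford m) :=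
  NormedSpace.induced ℂ (ComplexClifford m) (EuclideanSpace ℂ (Finset (Fin m))) (toEuclidean m)

variable {m}

/-- The generators `e_1, …, e_m`. -/
def e (j : Fin m) : ComplexClifford m :=
  (1 : ℂ) ⊗ₜ[ℝ] CliffordAlgebra.ι (cliffordForm m) (Pi.single j 1)

/-- The (complex) 1-vector `z̲ = z₁ e₁ + ⋯ + z_m e_m`. -/
def vec (z : EuclideanSpace ℂ (Fin m)) : ComplexClifford m := ∑ j, z j • e j

end ComplexClifford

open ComplexClifford

variable {m : ℕ}

/-- The inclusion `ℝ^m ⊆ ℂ^m`. -/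
def realToComplex (x : EuclideanSpace ℝ (Fin m)) : EuclideanSpace ℂ (Fin m) :=
  WithLp.toLp 2 (fun j => (x j : ℂ))

/-- The bilinear (not sesquilinear) product `z · w = ∑ z_j w_j` on `ℂ^m`. -/
def cdot (z w : EuclideanSpace ℂ (Fin m)) : ℂ := ∑ j, z j * w j

/-- The Dirac operator `∑ e_j ∂_j`, for functions on `𝕜^m` with `𝕜 = ℝ` (this is `∂_x̲`) or `𝕜 = ℂ`
(this is the complexified operator `∂_z̲`). -/
def dirac (𝕜 : Type*) [RCLike 𝕜] [NormedSpace 𝕜 (ComplexClifford m)]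
    (F : EuclideanSpace 𝕜 (Fin m) → ComplexClifford m) (x : EuclideanSpace 𝕜 (Fin m)) :
    ComplexClifford m :=
  ∑ j, e j * fderiv 𝕜 F x (EuclideanSpace.single j 1)

/-- (Left) monogenic functions on `ℝ^m`. -/
def IsMonogenic (g : EuclideanSpace ℝ (Fin m) → ComplexClifford m) : Prop :=
  ContDiff ℝ 1 g ∧ ∀ x, dirac ℝ g x = 0

/-- Complex (left) monogenic functions: entire functions on `ℂ^m` killed by `∂_z̲`. -/
def IsComplexMonogenic (F : EuclideanSpace ℂ (Fin m) → ComplexClifford m) : Prop :=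
  Differentiable ℂ F ∧ ∀ z, dirac ℂ F z = 0

/-- `P(z) = ∑_{|α| = k} z^α c_α` with coefficients `c_α ∈ ℂ_m`. -/
def IsHomogPoly (k : ℕ) (P : EuclideanSpace ℂ (Fin m) → ComplexClifford m) : Prop :=
  ∃ c : (Fin m → ℕ) → ComplexClifford m,
    ∀ z, P z = ∑ α ∈ Finset.piAntidiag Finset.univ k, (∏ j, z j ^ α j) • c α

/-- `M` is the monogenic part of the homogeneous polynomial `R` of degree `k`: in the Fischer
decomposition `R(z) = M(z) + z̲ S(z)`, `M` is homogeneous of degree `k` and monogenic and `S` is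
homogeneous of degree `k - 1` (`S = 0` if `k = 0`). -/
def IsHomogMonogenicPart (k : ℕ) (R M : EuclideanSpace ℂ (Fin m) → ComplexClifford m) : Prop :=
  IsHomogPoly k M ∧ IsComplexMonogenic M ∧
    ∃ S : EuclideanSpace ℂ (Fin m) → ComplexClifford m,
      ((k = 0 ∧ S = 0) ∨ ∃ j, k = j + 1 ∧ IsHomogPoly j S) ∧ ∀ z, R z = M z + vec z * S z

/-- The homogeneous part of degree `k` of the Taylor series of `F` at the origin. -/
def taylorPart (k : ℕ) (F : EuclideanSpace ℂ (Fin m) → ComplexClifford m) :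
    EuclideanSpace ℂ (Fin m) → ComplexClifford m :=
  fun z => (k.factorial : ℂ)⁻¹ • iteratedFDeriv ℂ k F 0 (fun _ => z)

/-- `G` is the monogenic part of the entire function `F = ∑_k R_k` (`R_k` homogeneous of
degree `k`): `G(z) = ∑_k M_k(z)`, with `M_k` the monogenic part of `R_k`. -/
def HasMonogenicPart (F G : EuclideanSpace ℂ (Fin m) → ComplexClifford m) : Prop :=
  Differentiable ℂ F ∧
    ∃ M : ℕ → EuclideanSpace ℂ (Fin m) → ComplexClifford m,
      (∀ k, IsHomogMonogenicPart k (taylorPart k F) (M k)) ∧ ∀ z, HasSum (fun k => M k z) (G z)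

open Classical in
/-- The monogenic part `𝓜(F)` of an entire function `F` (and `0` if there is none). -/
def monogenicPart (F : EuclideanSpace ℂ (Fin m) → ComplexClifford m) :
    EuclideanSpace ℂ (Fin m) → ComplexClifford m :=
  if h : ∃ G, HasMonogenicPart F G then h.choose else 0

/-- The function `z ↦ e^{⟨z, u⟩}` on `ℂ^m`, for `u ∈ ℝ^m`. -/
def expPairing (u : EuclideanSpace ℝ (Fin m)) (z : EuclideanSpace ℂ (Fin m)) :
    ComplexClifford m :=
  Complex.exp (cdot z (realToComplex u)) • (1 : ComplexClifford m)

/-- The Fourier-Borel kernel `E(z, u)`: the monogenic part in `z` of `e^{⟨z, u⟩}`. -/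
def fourierBorelKernel (z : EuclideanSpace ℂ (Fin m)) (u : EuclideanSpace ℝ (Fin m)) :
    ComplexClifford m :=
  monogenicPart (expPairing u) z

/-- The integrand of the Segal-Bargmann-Fock transform. -/
def segalBargmannIntegrand (f : EuclideanSpace ℝ (Fin m) → ComplexClifford m)
    (z : EuclideanSpace ℂ (Fin m)) (x : EuclideanSpace ℝ (Fin m)) : ComplexClifford m :=
  Complex.exp (-cdot z z / 2 + cdot (realToComplex x) z
    - cdot (realToComplex x) (realToComplex x) / 4) • f x

/-- The Segal-Bargmann-Fock transform `𝓑[f]`. -/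
def segalBargmann (f : EuclideanSpace ℝ (Fin m) → ComplexClifford m)
    (z : EuclideanSpace ℂ (Fin m)) : ComplexClifford m :=
  ((2 * Real.pi) ^ (-(m : ℝ) / 2) : ℝ) • ∫ x, segalBargmannIntegrand f z x

/-- The partial derivative `∂_{x_j}`. -/
def partialDeriv (j : Fin m) (f : EuclideanSpace ℝ (Fin m) → ComplexClifford m) :
    EuclideanSpace ℝ (Fin m) → ComplexClifford m :=
  fun x => fderiv ℝ f x (EuclideanSpace.single j 1)

/-- The iterated partial derivative `∂^α = ∂_{x_1}^{α_1} ⋯ ∂_{x_m}^{α_m}`. -/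
def multiDeriv (α : Fin m → ℕ) (f : EuclideanSpace ℝ (Fin m) → ComplexClifford m) :
    EuclideanSpace ℝ (Fin m) → ComplexClifford m :=
  (List.finRange m).foldr (fun j h => (partialDeriv j)^[α j] h) f

/-- The Taylor coefficient `∂^α R(0) / α!`. -/
def taylorCoeff (α : Fin m → ℕ) (R : EuclideanSpace ℝ (Fin m) → ComplexClifford m) :
    ComplexClifford m :=
  ((∏ j, (α j).factorial : ℕ) : ℝ)⁻¹ • multiDeriv α R 0

/-- The Fischer inner product `[R, S] = R(∂_x)† S(x) |_{x = 0}` of two real analytic functions on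
`ℝ^m` exists and equals `v`: if `R(x) = ∑_α x^α r_α` then `[R, S] = ∑_α r_α† ∂^α S(0)`. -/
def HasFischerInner (R S : EuclideanSpace ℝ (Fin m) → ComplexClifford m)
    (v : ComplexClifford m) : Prop :=
  AnalyticOnNhd ℝ R Set.univ ∧ AnalyticOnNhd ℝ S Set.univ ∧
    HasSum (fun α : Fin m → ℕ => star (taylorCoeff α R) * multiDeriv α S 0) v

end

/-! Everything is done on coefficients. An entire function is a family `c` with `∑ r ^ |α| ‖c α‖ <
∞` for every `r` (`EntireCoeff`), and `𝓜` is computed monomial by monomial: `𝓜(F)(z) = ∑_α M_α(z)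
c_α`, where `M_α` is the monogenic part of `z^α`.

The Fischer decomposition comes from orthogonality. There is a real inner product on `ℂ_m` for which
every `e_j` is skew (`exists_invariant_form`). For the Fischer form built on it, multiplication by
`z̲` is adjoint to `-∂_z̲` (`fischerForm_mulVecCoeff`), so the orthogonal complement of `z̲ 𝒫_{k-1}`
in `𝒫_k` consists of the monogenic polynomials. An orthogonal projection does not increase the
Fischer norm, which gives `‖M_α(z)‖ ≤ C ‖z‖ ^ |α|` with `C` independent of `α`
(`exists_monogenicMonomial`). All convergence statements about `𝓜` rest on this bound; in particular
`E(z, u) = ∑_α (u^α / α!) M_α(z)`.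

For the integral formula, put `w = (2π)^{-m/2} e^{-|x|²/2} g`, so that `𝓑[f](z) = e^{-z·z/2} ∫
e^{z·x} w(x) dx`. Since `z̲² = -z·z`, the factor `e^{-z·z/2}` is `∑_i (z̲²/2)^i / i!`, and `𝓜`
annihilates every term with `i ≥ 1` because it lies in the range of `z̲`
(`EntireCoeff.tsum_monogenicMonomial_gaussianCoeff`). What remains is `∑_α M_α(z) ∫ (x^α / α!) w = ∫
E(z, x) w(x) dx`. The interchange is legitimate because `w` is a Gaussian times an `L²` function,
hence integrable against every exponential.

At a real point `z`, completing the square turns `𝓑[f](z)` into the mean of `g` for the Gaussian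
centred at `z`. If `g` has the mean value property this is `g(z)`, so `g` is the restriction of the
entire function `𝓑[f]`. Harmonic functions have that property by integration by parts; for monogenic
functions, which are only assumed `C¹`, a first-order argument with the Clifford relations replaces
the Laplacian (`integral_radial_fderiv_of_monogenic`). In the harmonic case the Taylor coefficients
of `g` are therefore those of `𝓑[f]`, and the Fischer product with `E(z, ·)†` is the series for
`𝓜(𝓑[f])(z)` term by term (`hasFischerInner_kernel`). In the monogenic case `∂_z̲ 𝓑[f]` vanishes on
`ℝ^m`, hence everywhere, so `𝓑[f]` is its own monogenic part. -/

noncomputable section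

open Finset

/-! ### Entire power series in several variables -/

section PowerSeries

variable {m : ℕ} {V : Type*} [NormedAddCommGroup V]

/-- The monomial `z^α`. -/
def monom (z : EuclideanSpace ℂ (Fin m)) (α : Fin m → ℕ) : ℂ := ∏ j, z j ^ α j

/-- The coefficients `c` are those of an entire power series. -/
def EntireCoeff (c : (Fin m → ℕ) → V) : Prop :=
  ∀ r : ℝ, 0 ≤ r → Summable fun α => r ^ (∑ j, α j) * ‖c α‖

lemma norm_monom_le (z : EuclideanSpace ℂ (Fin m)) {r : ℝ} (hr : ∀ j, ‖z j‖ ≤ r)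
    (α : Fin m → ℕ) : ‖monom z α‖ ≤ r ^ ∑ j, α j := by
  rw [monom, norm_prod, ← Finset.prod_pow_eq_pow_sum]
  exact Finset.prod_le_prod (fun _ _ => norm_nonneg _) fun j _ => by
    rw [norm_pow]; exact pow_le_pow_left₀ (norm_nonneg _) (hr j) _

lemma hasSum_fiber {A : Type*} [AddCommMonoid A] [TopologicalSpace A]
    (f : (Fin m → ℕ) → A) (k : ℕ) :
    HasSum (fun x : {α : Fin m → ℕ // ∑ j, α j = k} => f x)
      (∑ α ∈ piAntidiag univ k, f α) := by
  have h := Finset.hasSum (piAntidiag univ k) f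
  let e : {α : Fin m → ℕ // ∑ j, α j = k} ≃ (piAntidiag (univ : Finset (Fin m)) k) :=
    Equiv.subtypeEquivRight fun α => by simp
  exact (e.hasSum_iff (f := fun x : (piAntidiag (univ : Finset (Fin m)) k) => f x)).2 h

lemma HasSum.sum_piAntidiag {A : Type*} [AddCommMonoid A] [TopologicalSpace A] [ContinuousAdd A]
    [RegularSpace A] {f : (Fin m → ℕ) → A} {a : A} (h : HasSum f a) :
    HasSum (fun k => ∑ α ∈ piAntidiag univ k, f α) a :=
  ((Equiv.sigmaFiberEquiv fun α : Fin m → ℕ => ∑ j, α j).hasSum_iff.2 h).sigma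
    fun k => hasSum_fiber f k

lemma summable_of_sum_piAntidiag {f : (Fin m → ℕ) → ℝ} (hf : ∀ α, 0 ≤ f α)
    (h : Summable fun k => ∑ α ∈ piAntidiag univ k, f α) : Summable f := by
  refine (Equiv.sigmaFiberEquiv fun α : Fin m → ℕ => ∑ j, α j).summable_iff.1
    ((summable_sigma_of_nonneg fun _ => hf _).2 ?_)
  exact ⟨fun k => (hasSum_fiber f k).summable, by
    simpa only [Function.comp_def, Equiv.sigmaFiberEquiv_apply,
      fun k => (hasSum_fiber f k).tsum_eq] using h⟩

/-- The multinomial theorem for divided powers. -/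
lemma sum_piAntidiag_prod_div_factorial {K : Type*} [Field K] [CharZero K] (x : Fin m → K)
    (k : ℕ) :
    ∑ α ∈ piAntidiag univ k, ∏ j, (x j ^ α j / ((α j).factorial : K))
      = (∑ j, x j) ^ k / (k.factorial : K) := by
  rw [Finset.sum_pow_eq_sum_piAntidiag, Finset.sum_div]
  refine Finset.sum_congr rfl fun α hα => ?_
  have h := Nat.multinomial_spec (univ : Finset (Fin m)) α
  rw [(mem_piAntidiag.1 hα).1] at h
  have h' : (∏ j, ((α j).factorial : K)) * (Nat.multinomial univ α : K) = (k.factorial : K) := by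
    exact_mod_cast h
  have h1 : (∏ j, ((α j).factorial : K)) ≠ 0 :=
    Finset.prod_ne_zero_iff.2 fun j _ => Nat.cast_ne_zero.2 (Nat.factorial_ne_zero _)
  have h2 : (k.factorial : K) ≠ 0 := Nat.cast_ne_zero.2 (Nat.factorial_ne_zero _)
  rw [Finset.prod_div_distrib, div_eq_div_iff h1 h2, ← h']
  ring

lemma summable_prod_div_factorial {x : Fin m → ℝ} (hx : ∀ j, 0 ≤ x j) :
    Summable fun α : Fin m → ℕ => ∏ j, (x j ^ α j / ((α j).factorial : ℝ)) := by
  refine summable_of_sum_piAntidiag (fun α => prod_nonneg fun j _ => ?_) ?_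
  · have := hx j; positivity
  · simp only [sum_piAntidiag_prod_div_factorial]
    exact Real.summable_pow_div_factorial _

lemma tsum_prod_div_factorial {x : Fin m → ℝ} (hx : ∀ j, 0 ≤ x j) :
    ∑' α : Fin m → ℕ, ∏ j, (x j ^ α j / ((α j).factorial : ℝ)) = Real.exp (∑ j, x j) := by
  have h := (summable_prod_div_factorial hx).hasSum.sum_piAntidiag
  simp only [sum_piAntidiag_prod_div_factorial] at h
  rw [Real.exp_eq_exp_ℝ, NormedSpace.exp_eq_tsum_div]
  exact h.tsum_eq.symm

lemma hasSum_prod_div_factorial (x : Fin m → ℂ) :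
    HasSum (fun α : Fin m → ℕ => ∏ j, (x j ^ α j / ((α j).factorial : ℂ)))
      (Complex.exp (∑ j, x j)) := by
  have hs : Summable fun α : Fin m → ℕ => ∏ j, (x j ^ α j / ((α j).factorial : ℂ)) := by
    refine Summable.of_norm ?_
    simpa [norm_prod] using summable_prod_div_factorial (x := fun j => ‖x j‖) (by simp)
  have h := hs.hasSum.sum_piAntidiag
  simp only [sum_piAntidiag_prod_div_factorial] at h
  rw [Complex.exp_eq_exp_ℂ, NormedSpace.exp_eq_tsum_div]
  have h' := hs.hasSum
  rwa [← h.tsum_eq] at h'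

variable [NormedSpace ℂ V]

/-- The sum of the power series with coefficients `c`. -/
def evalSeries (c : (Fin m → ℕ) → V) (z : EuclideanSpace ℂ (Fin m)) : V :=
  ∑' α, monom z α • c α

/-- The homogeneous part of degree `k` of the power series with coefficients `c`. -/
def homogPart (k : ℕ) (c : (Fin m → ℕ) → V) (z : EuclideanSpace ℂ (Fin m)) : V :=
  ∑ α ∈ piAntidiag univ k, monom z α • c α

lemma norm_monom_smul_le (c : (Fin m → ℕ) → V) (z : EuclideanSpace ℂ (Fin m)) (α : Fin m → ℕ) :
    ‖monom z α • c α‖ ≤ ‖z‖ ^ (∑ j, α j) * ‖c α‖ := by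
  rw [norm_smul]
  exact mul_le_mul_of_nonneg_right (norm_monom_le z (fun j => PiLp.norm_apply_le z j) α)
    (norm_nonneg _)

variable {c : (Fin m → ℕ) → V}

/-- Links coefficient families to formal multilinear series, and so to analyticity and to the
`iteratedFDeriv` in `taylorPart`. The norm bound holds because each coordinate functional has norm
at most one. -/
lemma exists_multilinear_homogPart (k : ℕ) (c : (Fin m → ℕ) → V) :
    ∃ p : ContinuousMultilinearMap ℂ (fun _ : Fin k => EuclideanSpace ℂ (Fin m)) V,
      (∀ z, p (fun _ => z) = homogPart k c z) ∧
      ‖p‖ ≤ ∑ α ∈ piAntidiag univ k, ‖c α‖ := by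
  have key : ∀ α ∈ piAntidiag (univ : Finset (Fin m)) k,
      ∃ p : ContinuousMultilinearMap ℂ (fun _ : Fin k => EuclideanSpace ℂ (Fin m)) V,
      (∀ z, p (fun _ => z) = monom z α • c α) ∧ ‖p‖ ≤ ‖c α‖ := by
    intro α hα
    obtain rfl : ∑ j, α j = k := (mem_piAntidiag.1 hα).1
    -- `σ` lists every index `j` exactly `α j` times, so the product of the coordinates `σ i` over
    -- all slots is `z^α`.
    let σ : Fin (∑ j, α j) → Fin m := fun i => (finSigmaFinEquiv.symm i).1
    let q : ContinuousMultilinearMap ℂ (fun _ : Fin (∑ j, α j) => EuclideanSpace ℂ (Fin m)) ℂ :=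
      (ContinuousMultilinearMap.mkPiAlgebra ℂ (Fin (∑ j, α j)) ℂ).compContinuousLinearMap
        fun i => EuclideanSpace.proj (σ i)
    refine ⟨q.smulRight (c α), fun z => ?_, ?_⟩
    · simp only [ContinuousMultilinearMap.smulRight_apply, q,
        ContinuousMultilinearMap.compContinuousLinearMap_apply,
        ContinuousMultilinearMap.mkPiAlgebra_apply]
      congr 1
      rw [← Equiv.prod_comp finSigmaFinEquiv]
      simp [σ, monom, Fintype.prod_sigma]
    · refine ContinuousMultilinearMap.opNorm_le_bound (norm_nonneg _) fun v => ?_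
      simp only [ContinuousMultilinearMap.smulRight_apply, q,
        ContinuousMultilinearMap.compContinuousLinearMap_apply,
        ContinuousMultilinearMap.mkPiAlgebra_apply]
      rw [norm_smul, mul_comm, norm_prod]
      refine mul_le_mul_of_nonneg_left (prod_le_prod (fun _ _ => norm_nonneg _) fun i _ => ?_)
        (norm_nonneg _)
      exact PiLp.norm_apply_le (v i) (σ i)
  choose! p hp hp' using key
  refine ⟨∑ α ∈ piAntidiag univ k, p α, fun z => ?_, ?_⟩
  · rw [_root_.sum_apply]
    exact Finset.sum_congr rfl fun α hα => hp α hα z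
  · exact (norm_sum_le _ _).trans (Finset.sum_le_sum hp')

variable [CompleteSpace V]

lemma EntireCoeff.summable (hc : EntireCoeff c) (z : EuclideanSpace ℂ (Fin m)) :
    Summable fun α => monom z α • c α :=
  Summable.of_norm_bounded (hc ‖z‖ (norm_nonneg _)) (norm_monom_smul_le c z)

lemma EntireCoeff.hasSum (hc : EntireCoeff c) (z : EuclideanSpace ℂ (Fin m)) :
    HasSum (fun α => monom z α • c α) (evalSeries c z) := (hc.summable z).hasSum

lemma EntireCoeff.hasSum_homogPart (hc : EntireCoeff c) (z : EuclideanSpace ℂ (Fin m)) :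
    HasSum (fun k => homogPart k c z) (evalSeries c z) := (hc.hasSum z).sum_piAntidiag

/-- An entire power series has a formal multilinear series with infinite radius. -/
lemma EntireCoeff.exists_hasFPowerSeriesOnBall (hc : EntireCoeff c) :
    ∃ p : FormalMultilinearSeries ℂ (EuclideanSpace ℂ (Fin m)) V,
      HasFPowerSeriesOnBall (evalSeries c) p 0 ⊤ ∧ ∀ k z, p k (fun _ => z) = homogPart k c z := by
  choose p hp hp' using fun k => exists_multilinear_homogPart k c
  refine ⟨p, ⟨?_, by simp, ?_⟩, hp⟩
  · rw [FormalMultilinearSeries.radius_eq_top_of_summable_norm p]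
    intro r
    have h := (hc r r.2).hasSum.sum_piAntidiag.summable
    refine Summable.of_nonneg_of_le (fun k => by positivity) (fun k => ?_) h
    rw [mul_comm]
    refine (mul_le_mul_of_nonneg_left (hp' k) (by positivity)).trans_eq ?_
    rw [Finset.mul_sum]
    exact Finset.sum_congr rfl fun α hα => by rw [(mem_piAntidiag.1 hα).1]
  · intro z _
    simpa [hp] using hc.hasSum_homogPart z

lemma EntireCoeff.analyticOnNhd (hc : EntireCoeff c) :
    AnalyticOnNhd ℂ (evalSeries c) Set.univ := by
  obtain ⟨p, hp, -⟩ := hc.exists_hasFPowerSeriesOnBall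
  simpa using hp.analyticOnNhd

lemma EntireCoeff.differentiable (hc : EntireCoeff c) : Differentiable ℂ (evalSeries c) :=
  fun z => (hc.analyticOnNhd z trivial).differentiableAt

/-- The multilinear maps constructed above need not be symmetric; this is harmless because the
iterated derivative is evaluated on the diagonal only. -/
lemma EntireCoeff.iteratedFDeriv (hc : EntireCoeff c) (k : ℕ) (z : EuclideanSpace ℂ (Fin m)) :
    (k.factorial : ℂ)⁻¹ • iteratedFDeriv ℂ k (evalSeries c) 0 (fun _ => z) = homogPart k c z := by
  obtain ⟨p, hp, hp'⟩ := hc.exists_hasFPowerSeriesOnBall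
  rw [← hp.factorial_smul, hp', ← Nat.cast_smul_eq_nsmul ℂ, smul_smul, inv_mul_cancel₀, one_smul]
  exact Nat.cast_ne_zero.2 (Nat.factorial_ne_zero _)

end PowerSeries
end

noncomputable section

open Finset

/-! ### Termwise differentiation, and restriction to real points -/

section Derivatives

variable {m : ℕ} {V : Type*} [NormedAddCommGroup V] [NormedSpace ℂ V]

/-- The coefficients of the partial derivative `∂_j` of a power series. -/
def derivCoeff (j : Fin m) (c : (Fin m → ℕ) → V) (α : Fin m → ℕ) : V :=
  ((α j + 1 : ℕ) : ℂ) • c (α + Pi.single j 1)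

lemma sum_add_single (j : Fin m) (α : Fin m → ℕ) :
    ∑ i, (α + Pi.single j 1 : Fin m → ℕ) i = ∑ i, α i + 1 := by
  simp [Finset.sum_add_distrib]

lemma natCast_apply_le_two_pow_sum (α : Fin m → ℕ) (j : Fin m) :
    (α j : ℝ) ≤ 2 ^ ∑ i, α i := by
  have h1 : α j ≤ ∑ i, α i := Finset.single_le_sum (fun _ _ => Nat.zero_le _) (mem_univ j)
  have h2 : α j ≤ 2 ^ ∑ i, α i := h1.trans Nat.lt_two_pow_self.le
  exact_mod_cast h2

variable {c : (Fin m → ℕ) → V}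

lemma EntireCoeff.derivCoeff (hc : EntireCoeff c) (j : Fin m) : EntireCoeff (derivCoeff j c) := by
  intro r hr
  -- The factor 2 absorbs `α j + 1 ≤ 2 ^ (|α| + 1)`; replacing `r` by `r + 1 ≥ 1` absorbs the shift
  -- of the degree by one.
  have h := (hc (2 * (r + 1)) (by positivity)).comp_injective
    (add_left_injective (Pi.single j 1 : Fin m → ℕ))
  refine Summable.of_nonneg_of_le (fun α => by positivity) (fun α => ?_) h
  simp only [Function.comp_apply, _root_.derivCoeff, norm_smul, ← mul_assoc, Complex.norm_natCast]
  refine mul_le_mul_of_nonneg_right ?_ (norm_nonneg _)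
  have h1 := natCast_apply_le_two_pow_sum (α + Pi.single j 1) j
  rw [sum_add_single] at h1 ⊢
  rw [mul_pow, mul_comm]
  refine mul_le_mul (by simpa using h1) ?_ (by positivity) (by positivity)
  calc r ^ (∑ i, α i) ≤ (r + 1) ^ (∑ i, α i) := pow_le_pow_left₀ hr (by linarith) _
    _ ≤ (r + 1) ^ (∑ i, α i + 1) := pow_le_pow_right₀ (by linarith) (Nat.le_succ _)

lemma monom_eq (z : EuclideanSpace ℂ (Fin m)) (j : Fin m) (α : Fin m → ℕ) :
    monom z α = z j ^ α j * ∏ i ∈ univ.erase j, z i ^ α i :=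
  (Finset.mul_prod_erase _ (fun i => z i ^ α i) (mem_univ j)).symm

lemma monom_add_smul_single (z : EuclideanSpace ℂ (Fin m)) (j : Fin m) (t : ℂ) (α : Fin m → ℕ) :
    monom (z + t • EuclideanSpace.single j 1) α
      = (z j + t) ^ α j * ∏ i ∈ univ.erase j, z i ^ α i := by
  rw [monom_eq _ j]
  congr 1
  · simp
  · refine prod_congr rfl fun i hi => ?_
    have : i ≠ j := (mem_erase.1 hi).1
    simp [this]

variable [CompleteSpace V]

lemma EntireCoeff.hasDerivAt (hc : EntireCoeff c) (z : EuclideanSpace ℂ (Fin m)) (j : Fin m) :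
    HasDerivAt (fun t : ℂ => evalSeries c (z + t • EuclideanSpace.single j 1))
      (evalSeries (_root_.derivCoeff j c) z) 0 := by
  -- `R` bounds `‖z j + t‖` for `‖t‖ < 1`, and `R ≥ 1` allows the exponent `α j - 1` to be raised to
  -- `α j`.
  set R : ℝ := ‖z‖ + 1 with hR
  have hR1 : 1 ≤ R := by rw [hR]; linarith [norm_nonneg z]
  let g : (Fin m → ℕ) → ℂ → V := fun α t => monom (z + t • EuclideanSpace.single j 1) α • c α
  let g' : (Fin m → ℕ) → ℂ → V := fun α t =>
    ((α j * (z j + t) ^ (α j - 1)) * ∏ i ∈ univ.erase j, z i ^ α i) • c α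
  have hz : ∀ i, ‖z i‖ ≤ ‖z‖ := fun i => PiLp.norm_apply_le z i
  have h1 : ∀ α t, t ∈ Metric.ball (0 : ℂ) 1 → HasDerivAt (g α) (g' α t) t := by
    intro α t _
    simp only [g, g', monom_add_smul_single]
    have := (((hasDerivAt_id t).const_add (z j)).pow (α j)).mul_const
      (∏ i ∈ univ.erase j, z i ^ α i)
    simpa using this.smul_const (c α)
  have h2 : ∀ α t, t ∈ Metric.ball (0 : ℂ) 1 → ‖g' α t‖ ≤ (2 * R) ^ (∑ i, α i) * ‖c α‖ := by
    intro α t ht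
    have ht' : ‖z j + t‖ ≤ R := by
      refine (norm_add_le _ _).trans ?_
      rw [mem_ball_zero_iff] at ht
      linarith [hz j]
    rw [norm_smul]
    refine mul_le_mul_of_nonneg_right ?_ (norm_nonneg _)
    rw [norm_mul, norm_mul, norm_pow, Complex.norm_natCast, norm_prod, mul_pow, mul_assoc]
    refine mul_le_mul (natCast_apply_le_two_pow_sum α j) ?_ (by positivity) (by positivity)
    rw [← prod_pow_eq_pow_sum, ← Finset.mul_prod_erase _ _ (mem_univ j)]
    refine mul_le_mul ?_ (prod_le_prod (fun _ _ => norm_nonneg _) fun i _ => ?_)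
      (prod_nonneg fun _ _ => norm_nonneg _) (by positivity)
    · exact (pow_le_pow_left₀ (norm_nonneg _) ht' _).trans
        (pow_le_pow_right₀ hR1 (Nat.sub_le _ _))
    · rw [norm_pow]
      exact pow_le_pow_left₀ (norm_nonneg _) (by linarith [hz i]) _
  have h0 : (0 : ℂ) ∈ Metric.ball (0 : ℂ) 1 := by simp
  have h := hasDerivAt_tsum_of_isPreconnected (hc (2 * R) (by positivity)) Metric.isOpen_ball
    (convex_ball (0 : ℂ) 1).isPreconnected h1 h2 h0 (by simpa [g] using hc.summable z) h0
  convert! h using 1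
  -- Reindex by `α ↦ α + e_j`: the terms with `α j = 0` carry the factor `α j` and vanish.
  rw [← (add_left_injective (Pi.single j 1 : Fin m → ℕ)).tsum_eq]
  · refine tsum_congr fun α => ?_
    simp only [g', _root_.derivCoeff, smul_smul]
    congr 1
    have : ∏ i ∈ univ.erase j, z i ^ (α + Pi.single j 1 : Fin m → ℕ) i
        = ∏ i ∈ univ.erase j, z i ^ α i := by
      refine prod_congr rfl fun i hi => ?_
      simp [(mem_erase.1 hi).1]
    rw [this, monom_eq z j]
    simp
    ring
  · intro α hα
    have h3 : α j ≠ 0 := by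
      intro h3
      simp [g', h3] at hα
    refine ⟨α - Pi.single j 1, ?_⟩
    funext i
    by_cases hi : i = j
    · subst hi
      simp
      omega
    · simp [hi]

lemma EntireCoeff.fderiv_single (hc : EntireCoeff c) (z : EuclideanSpace ℂ (Fin m)) (j : Fin m) :
    fderiv ℂ (evalSeries c) z (EuclideanSpace.single j 1)
      = evalSeries (_root_.derivCoeff j c) z := by
  have h1 := (hc.differentiable z).hasFDerivAt.hasLineDerivAt (EuclideanSpace.single j 1)
  exact h1.unique (hc.hasDerivAt z j)

/-- The inclusion `ℝ^m ⊆ ℂ^m` as a continuous linear map. -/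
def realToComplexCLM (m : ℕ) : EuclideanSpace ℝ (Fin m) →L[ℝ] EuclideanSpace ℂ (Fin m) :=
  LinearMap.toContinuousLinearMap
    { toFun := realToComplex
      map_add' := fun x y => by ext j; simp [realToComplex]
      map_smul' := fun r x => by ext j; simp [realToComplex] }

lemma EntireCoeff.hasFDerivAt_real (hc : EntireCoeff c) (x : EuclideanSpace ℝ (Fin m)) :
    HasFDerivAt (fun x => evalSeries c (realToComplex x))
      (((fderiv ℂ (evalSeries c) (realToComplex x)).restrictScalars ℝ).comp
        (realToComplexCLM m)) x :=
  HasFDerivAt.comp (g := evalSeries c) (f := realToComplexCLM m) x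
    ((hc.differentiable (realToComplex x)).hasFDerivAt.restrictScalars ℝ)
    (realToComplexCLM m).hasFDerivAt

lemma realToComplex_single (j : Fin m) :
    realToComplex (EuclideanSpace.single j 1) = EuclideanSpace.single j 1 := by
  ext i
  by_cases h : i = j <;> simp [realToComplex, h]

lemma EntireCoeff.fderiv_real_single (hc : EntireCoeff c) (x : EuclideanSpace ℝ (Fin m))
    (j : Fin m) :
    fderiv ℝ (fun x => evalSeries c (realToComplex x)) x (EuclideanSpace.single j 1)
      = evalSeries (_root_.derivCoeff j c) (realToComplex x) := by
  rw [(hc.hasFDerivAt_real x).fderiv, ← hc.fderiv_single, ← realToComplex_single]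
  rfl

lemma EntireCoeff.analyticOnNhd_real (hc : EntireCoeff c) :
    AnalyticOnNhd ℝ (fun x => evalSeries c (realToComplex x)) Set.univ := fun x _ =>
  AnalyticAt.comp (g := evalSeries c) (f := realToComplexCLM m)
    (hc.analyticOnNhd _ trivial).restrictScalars ((realToComplexCLM m).analyticAt x)

end Derivatives

/-! ### Taylor coefficients at the origin -/

section MultiDeriv

variable {m : ℕ} {c : (Fin m → ℕ) → ComplexClifford m}

instance : FiniteDimensional ℂ (ComplexClifford m) := (ComplexClifford.basis m).finiteDimensional_of_finite

instance : CompleteSpace (ComplexClifford m) := FiniteDimensional.complete ℂ _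

lemma partialDeriv_evalSeries (hc : EntireCoeff c) (j : Fin m) :
    partialDeriv j (fun x => evalSeries c (realToComplex x))
      = fun x => evalSeries (derivCoeff j c) (realToComplex x) :=
  funext fun x => hc.fderiv_real_single x j

/-- Iterating `∂_{j}` over a duplicate-free list of indices. -/
lemma foldr_partialDeriv_evalSeries (hc : EntireCoeff c) (α : Fin m → ℕ) :
    ∀ l : List (Fin m), l.Nodup → ∃ d : (Fin m → ℕ) → ComplexClifford m, EntireCoeff d ∧
      l.foldr (fun j h => (partialDeriv j)^[α j] h) (fun x => evalSeries c (realToComplex x))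
        = (fun x => evalSeries d (realToComplex x)) ∧
      ∀ β, (∀ j ∈ l, β j = 0) →
        d β = ((l.map fun j => (α j).factorial).prod : ℂ) •
          c (fun i => if i ∈ l then α i else β i) := by
  intro l
  induction l with
  | nil => exact fun _ => ⟨c, hc, rfl, fun β _ => by simp⟩
  | cons j l ih =>
    intro hl
    obtain ⟨hj, hl⟩ := List.nodup_cons.1 hl
    obtain ⟨d, hd, hd1, hd2⟩ := ih hl
    -- `n` derivatives in one variable produce the rising product `(β_j + 1) ⋯ (β_j + n)`, which is
    -- `n!` at `β_j = 0`. Only coefficients with `β = 0` on the list are tracked, so each coordinate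
    -- contributes a plain factorial.
    have key : ∀ n : ℕ, ∃ d' : (Fin m → ℕ) → ComplexClifford m, EntireCoeff d' ∧
        (partialDeriv j)^[n] (fun x => evalSeries d (realToComplex x))
          = (fun x => evalSeries d' (realToComplex x)) ∧
        ∀ β, d' β = (∏ i ∈ range n, (β j + i + 1 : ℂ)) • d (β + Pi.single j n) := by
      intro n
      induction n with
      | zero => exact ⟨d, hd, rfl, fun β => by simp⟩
      | succ n ihn =>
        obtain ⟨d', h1, h2, h3⟩ := ihn
        refine ⟨derivCoeff j d', h1.derivCoeff j, ?_, fun β => ?_⟩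
        · rw [Function.iterate_succ_apply', h2, partialDeriv_evalSeries h1]
        · rw [derivCoeff, h3, smul_smul, prod_range_succ', add_assoc β, ← Pi.single_add,
            add_comm 1 n]
          congr 1
          rw [mul_comm]
          congr 1
          · refine prod_congr rfl fun i _ => ?_
            simp
            ring
          · simp
    obtain ⟨d', h1, h2, h3⟩ := key (α j)
    refine ⟨d', h1, ?_, fun β hβ => ?_⟩
    · rw [List.foldr_cons, hd1, h2]
    · have hβj : β j = 0 := hβ j (by simp)
      rw [h3, hd2, smul_smul, List.map_cons, List.prod_cons]
      · congr 1
        · rw [hβj, ← Finset.prod_range_add_one_eq_factorial]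
          push_cast
          simp
        · congr 1
          funext i
          by_cases hi : i = j
          · subst hi; simp [hj, hβj]
          · simp [hi]
      · intro i hi
        have hij : i ≠ j := fun h => hj (h ▸ hi)
        simp [hij, hβ i (List.mem_cons_of_mem _ hi)]

lemma evalSeries_realToComplex_zero (c : (Fin m → ℕ) → ComplexClifford m) :
    evalSeries c (realToComplex 0) = c 0 := by
  rw [evalSeries, tsum_eq_single 0]
  · simp [monom]
  · intro α hα
    obtain ⟨j, hj⟩ : ∃ j, α j ≠ 0 := Function.ne_iff.1 hα
    rw [monom, prod_eq_zero (mem_univ j), zero_smul]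
    simp [realToComplex, hj]

lemma multiDeriv_evalSeries (hc : EntireCoeff c) (α : Fin m → ℕ) :
    multiDeriv α (fun x => evalSeries c (realToComplex x)) 0
      = ((∏ j, (α j).factorial : ℕ) : ℂ) • c α := by
  obtain ⟨d, -, h1, h2⟩ := foldr_partialDeriv_evalSeries hc α (List.finRange m)
    (List.nodup_finRange m)
  rw [multiDeriv, h1]
  show evalSeries d (realToComplex 0) = _
  rw [evalSeries_realToComplex_zero, h2 0 (fun _ _ => rfl)]
  congr 1
  simp

lemma taylorCoeff_evalSeries (hc : EntireCoeff c) (α : Fin m → ℕ) :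
    taylorCoeff α (fun x => evalSeries c (realToComplex x)) = c α := by
  have h : ((∏ j, (α j).factorial : ℕ) : ℂ) ≠ 0 :=
    Nat.cast_ne_zero.2 (prod_ne_zero_iff.2 fun j _ => Nat.factorial_ne_zero _)
  rw [taylorCoeff, multiDeriv_evalSeries hc, ← Complex.coe_smul, smul_smul]
  push_cast at h ⊢
  rw [inv_mul_cancel₀ h, one_smul]

/-- The coefficients of an entire power series are determined by its values on `ℝ^m`. -/
lemma EntireCoeff.ext_real {c d : (Fin m → ℕ) → ComplexClifford m} (hc : EntireCoeff c)
    (hd : EntireCoeff d)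
    (h : ∀ x, evalSeries c (realToComplex x) = evalSeries d (realToComplex x)) : c = d := by
  funext α
  rw [← taylorCoeff_evalSeries hc, ← taylorCoeff_evalSeries hd, funext h]

lemma taylorPart_evalSeries (hc : EntireCoeff c) (k : ℕ) :
    taylorPart k (evalSeries c) = homogPart k c :=
  funext fun z => hc.iteratedFDeriv k z

end MultiDeriv
end

noncomputable section

open Finset

/-! ### Clifford relations, and an inner product with skew generators -/

namespace ComplexClifford

variable {m : ℕ}

/-- The inclusion `ℝ_m ⊆ ℂ_m`. -/
def ofRealClifford (m : ℕ) : CliffordAlgebra (cliffordForm m) →+* ComplexClifford m :=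
  (Algebra.TensorProduct.includeRight :
    CliffordAlgebra (cliffordForm m) →ₐ[ℝ] ℂ ⊗[ℝ] CliffordAlgebra (cliffordForm m)).toRingHom

lemma e_eq (j : Fin m) :
    e j = ofRealClifford m (CliffordAlgebra.ι (cliffordForm m) (Pi.single j 1)) := rfl

lemma cliffordForm_single (j : Fin m) : cliffordForm m (Pi.single j 1) = -1 := by
  simp [cliffordForm, QuadraticMap.weightedSumSquares_apply, Pi.single_apply]

lemma e_mul_self (j : Fin m) : e j * e j = (-1 : ComplexClifford m) := by
  rw [e_eq, ← map_mul, CliffordAlgebra.ι_sq_scalar, cliffordForm_single, map_neg, map_one,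
    map_neg, map_one]

lemma e_mul_e_of_ne {j k : Fin m} (h : j ≠ k) : e j * e k = -(e k * e j) := by
  rw [e_eq, e_eq, ← map_mul (ofRealClifford m), ← map_mul (ofRealClifford m), ← map_neg]
  congr 1
  have := CliffordAlgebra.ι_mul_ι_add_swap (Q := cliffordForm m) (Pi.single j 1) (Pi.single k 1)
  have hp : QuadraticMap.polar (cliffordForm m) (Pi.single j 1) (Pi.single k 1) = 0 := by
    simp only [QuadraticMap.polar, cliffordForm_single]
    simp [cliffordForm, QuadraticMap.weightedSumSquares_apply, Pi.single_apply, mul_add,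
      h, h.symm, Finset.sum_add_distrib]
  rw [hp, map_zero] at this
  exact eq_neg_of_add_eq_zero_left this

lemma e_mul_e_mul_of_ne {j k : Fin m} (h : j ≠ k) (a : ComplexClifford m) :
    e j * (e k * a) = -(e k * (e j * a)) := by
  rw [← mul_assoc, e_mul_e_of_ne h, neg_mul, mul_assoc]

lemma e_mul_e_mul_self (j : Fin m) (a : ComplexClifford m) : e j * (e j * a) = -a := by
  rw [← mul_assoc, e_mul_self, neg_one_mul]

/-- A double sum against `e_j e_k` only sees the diagonal, if the coefficients are symmetric. -/
lemma sum_e_mul_e_mul_of_symm (A : Fin m → Fin m → ComplexClifford m)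
    (hA : ∀ j k, j ≠ k → A j k = A k j) :
    ∑ j, ∑ k, e j * (e k * A j k) = -∑ j, A j j := by
  have h : ∀ j k, e j * (e k * A j k) + e k * (e j * A k j) = if j = k then -(2 : ℂ) • A j j
      else 0 := by
    intro j k
    split_ifs with h
    · subst h
      rw [e_mul_e_mul_self, neg_smul, two_smul]
      abel
    · rw [hA j k h, e_mul_e_mul_of_ne h, neg_add_cancel]
  have h2 : ∑ j, ∑ k, e j * (e k * A j k) + ∑ j, ∑ k, e j * (e k * A j k)
      = -(2 : ℂ) • ∑ j, A j j := by
    nth_rewrite 2 [Finset.sum_comm]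
    rw [← Finset.sum_add_distrib, Finset.smul_sum]
    refine Finset.sum_congr rfl fun j _ => ?_
    rw [← Finset.sum_add_distrib]
    simp [h]
  have h3 : (2 : ℂ) • ∑ j, ∑ k, e j * (e k * A j k) = (2 : ℂ) • -∑ j, A j j := by
    rw [two_smul, h2, neg_smul, smul_neg]
  exact smul_right_injective _ (two_ne_zero' ℂ) h3

lemma vec_mul (z : EuclideanSpace ℂ (Fin m)) (a : ComplexClifford m) :
    vec z * a = ∑ j, z j • (e j * a) := by
  rw [vec, Finset.sum_mul]
  exact Finset.sum_congr rfl fun j _ => smul_mul_assoc _ _ _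

lemma vec_mul_vec_mul (z : EuclideanSpace ℂ (Fin m)) (a : ComplexClifford m) :
    vec z * (vec z * a) = -(cdot z z • a) := by
  have h := sum_e_mul_e_mul_of_symm (fun j k => (z j * z k) • a)
    (fun j k _ => by rw [mul_comm (z j)])
  rw [cdot, Finset.sum_smul, ← h, vec_mul]
  refine Finset.sum_congr rfl fun j _ => ?_
  rw [vec_mul, Finset.mul_sum, Finset.smul_sum]
  refine Finset.sum_congr rfl fun k _ => ?_
  rw [mul_smul_comm, smul_smul, mul_smul_comm, mul_smul_comm]

/-- Left multiplication as a continuous linear map. -/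
def mulCLM : ComplexClifford m →L[ℂ] ComplexClifford m →L[ℂ] ComplexClifford m :=
  LinearMap.toContinuousLinearMap
    (LinearMap.toContinuousLinearMap.toLinearMap ∘ₗ LinearMap.mul ℂ (ComplexClifford m))

@[simp] lemma mulCLM_apply (a b : ComplexClifford m) : mulCLM a b = a * b := rfl

lemma exists_norm_mul_le (m : ℕ) :
    ∃ C : ℝ, 0 ≤ C ∧ ∀ a b : ComplexClifford m, ‖a * b‖ ≤ C * ‖a‖ * ‖b‖ :=
  ⟨‖mulCLM (m := m)‖, mulCLM.opNorm_nonneg, fun a b => mulCLM.le_opNorm₂ a b⟩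

/-- Hermitian conjugation as a continuous real linear map. -/
def starCLM (m : ℕ) : ComplexClifford m →L[ℝ] ComplexClifford m :=
  haveI : FiniteDimensional ℝ (ComplexClifford m) := FiniteDimensional.complexToReal _
  LinearMap.toContinuousLinearMap
    { toFun := star
      map_add' := star_add
      map_smul' := fun r a => by
        have h := star_smul r (show ℂ ⊗[ℝ] CliffordAlgebra (cliffordForm m) from a)
        -- The real scalar action on `ComplexClifford` is restricted from `ℂ`, whereas the tensor
        -- product has its own; the two agree.
        have h2 : ∀ b : ComplexClifford m, r • b =
          (r • (show ℂ ⊗[ℝ] CliffordAlgebra (cliffordForm m) from b) :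
            ℂ ⊗[ℝ] CliffordAlgebra (cliffordForm m)) := fun b =>
              algebraMap_smul (M := ℂ ⊗[ℝ] CliffordAlgebra (cliffordForm m)) ℂ r b
        rw [h2]
        exact h.trans (h2 _).symm }

@[simp] lemma starCLM_apply (a : ComplexClifford m) : starCLM m a = star a := rfl

/-- A real inner product on the complex Clifford algebra for which the generators act as
isometries. -/
lemma exists_invariant_form (m : ℕ) :
    ∃ Q : ComplexClifford m →ₗ[ℝ] ComplexClifford m →ₗ[ℝ] ℝ,
      (∀ a b, Q a b = Q b a) ∧ (∀ a, ‖a‖ ^ 2 ≤ Q a a) ∧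
      ∀ j a b, Q (e j * a) b = -Q a (e j * b) := by
  -- Make the form invariant under one generator at a time, replacing `Q` by `Q + Q(e_j ·, e_j ·)`.
  -- The sum is `e_j`-invariant because `e_j² = -1` exchanges its two terms up to signs that cancel,
  -- and invariance under an earlier `e_i` survives because `e_i` and `e_j` anticommute.
  have key : ∀ s : Finset (Fin m), ∃ Q : ComplexClifford m →ₗ[ℝ] ComplexClifford m →ₗ[ℝ] ℝ,
      (∀ a b, Q a b = Q b a) ∧ (∀ a, ‖a‖ ^ 2 ≤ Q a a) ∧
      ∀ j ∈ s, ∀ a b, Q (e j * a) (e j * b) = Q a b := by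
    intro s
    induction s using Finset.induction_on with
    | empty =>
      let T : ComplexClifford m →ₗ[ℝ] EuclideanSpace ℂ (Finset (Fin m)) :=
        (toEuclidean m).restrictScalars ℝ
      refine ⟨LinearMap.mk₂ ℝ (fun a b => (inner ℂ (T a) (T b)).re) ?_ ?_ ?_ ?_, ?_, ?_, by simp⟩
      · intro a b c; rw [map_add, inner_add_left, Complex.add_re]
      · intro r a b
        rw [map_smul, ← Complex.coe_smul, inner_smul_left]; simp
      · intro a b c; rw [map_add, inner_add_right, Complex.add_re]
      · intro r a b
        rw [map_smul, ← Complex.coe_smul, inner_smul_right]; simp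
      · intro a b
        simp only [LinearMap.mk₂_apply]
        rw [← inner_conj_symm, Complex.conj_re]
      · intro a
        simp only [LinearMap.mk₂_apply]
        have h : ‖a‖ = ‖T a‖ := rfl
        rw [h]
        exact (inner_self_eq_norm_sq (𝕜 := ℂ) (T a)).ge
    | insert j s hj ih =>
      obtain ⟨Q, h1, h2, h3⟩ := ih
      let Lj : ComplexClifford m →ₗ[ℝ] ComplexClifford m :=
        (LinearMap.mulLeft ℂ (e j)).restrictScalars ℝ
      have hQ : ∀ a b, (Q + Q.compl₁₂ Lj Lj) a b = Q a b + Q (e j * a) (e j * b) :=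
        fun a b => rfl
      refine ⟨Q + Q.compl₁₂ Lj Lj, fun a b => ?_, fun a => ?_, fun i hi a b => ?_⟩
      · rw [hQ, hQ, h1, h1 (e j * a)]
      · rw [hQ]
        have := h2 (e j * a)
        nlinarith [h2 a, sq_nonneg ‖e j * a‖]
      · rw [hQ, hQ]
        by_cases hij : i = j
        · subst hij
          simp only [e_mul_e_mul_self, map_neg, LinearMap.neg_apply, neg_neg]
          rw [add_comm]
        · have his : i ∈ s := (Finset.mem_insert.1 hi).resolve_left hij
          have hji : j ≠ i := fun h => hij h.symm
          rw [e_mul_e_mul_of_ne hji, e_mul_e_mul_of_ne hji]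
          simp only [map_neg, LinearMap.neg_apply, neg_neg, h3 i his]
  obtain ⟨Q, h1, h2, h3⟩ := key univ
  refine ⟨Q, h1, h2, fun j a b => ?_⟩
  -- Skewness is invariance together with `e_j² = -1`: `Q(e_j a, b) = Q(e_j e_j a, e_j b) = -Q(a,
  -- e_j b)`.
  rw [← h3 j (mem_univ j) (e j * a) b, e_mul_e_mul_self]
  simp

end ComplexClifford
end

noncomputable section

open Finset ComplexClifford

/-! ### Multiplication by `z̲`, the Dirac operator and the Fischer decomposition on coefficients -/

section Fischer

variable {m : ℕ}

/-- The coefficients of `e_j z_j F`, if `c` are those of `F`. -/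
def mulCoordCoeff (j : Fin m) (c : (Fin m → ℕ) → ComplexClifford m) (α : Fin m → ℕ) :
    ComplexClifford m :=
  if α j = 0 then 0 else e j * c (α - Pi.single j 1)

/-- The coefficients of `z̲ F`, if `c` are those of `F`. -/
def mulVecCoeff (c : (Fin m → ℕ) → ComplexClifford m) (α : Fin m → ℕ) : ComplexClifford m :=
  ∑ j, mulCoordCoeff j c α

/-- The coefficients of `∂_z̲ F`, if `c` are those of `F`. -/
def diracCoeff (c : (Fin m → ℕ) → ComplexClifford m) (α : Fin m → ℕ) : ComplexClifford m :=
  ∑ j, e j * derivCoeff j c α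

lemma sub_add_single {α : Fin m → ℕ} {j : Fin m} (h : α j ≠ 0) :
    α - Pi.single j 1 + Pi.single j 1 = α := by
  funext i
  by_cases hi : i = j
  · subst hi
    simp
    omega
  · simp [hi]

lemma add_single_sub (α : Fin m → ℕ) (j : Fin m) :
    α + Pi.single j 1 - Pi.single j 1 = α := by
  funext i
  simp

@[simp] lemma mulCoordCoeff_add_single (j : Fin m) (c : (Fin m → ℕ) → ComplexClifford m)
    (α : Fin m → ℕ) : mulCoordCoeff j c (α + Pi.single j 1) = e j * c α := by
  simp only [mulCoordCoeff, add_single_sub]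
  simp

lemma mem_range_add_single {α : Fin m → ℕ} {j : Fin m} (h : α j ≠ 0) :
    α ∈ Set.range fun β : Fin m → ℕ => β + Pi.single j 1 :=
  ⟨_, sub_add_single h⟩

lemma mulCoordCoeff_of_notMem {α : Fin m → ℕ} {j : Fin m}
    (h : α ∉ Set.range fun β : Fin m → ℕ => β + Pi.single j 1)
    (c : (Fin m → ℕ) → ComplexClifford m) : mulCoordCoeff j c α = 0 := by
  by_cases hα : α j = 0
  · simp [mulCoordCoeff, hα]
  · exact absurd (mem_range_add_single hα) h

lemma sum_piAntidiag_succ {A : Type*} [AddCommMonoid A] (j : Fin m) (k : ℕ)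
    (f : (Fin m → ℕ) → A) (hf : ∀ α, α j = 0 → f α = 0) :
    ∑ α ∈ piAntidiag univ (k + 1), f α = ∑ α ∈ piAntidiag univ k, f (α + Pi.single j 1) := by
  symm
  refine Finset.sum_bij_ne_zero (fun α _ _ => α + Pi.single j 1) (fun α hα _ => ?_)
    (fun α _ _ β _ _ h => add_left_injective _ h) (fun α hα h => ?_) fun _ _ _ => rfl
  · have := (mem_piAntidiag.1 hα).1
    rw [mem_piAntidiag, sum_add_single, this]
    simp
  · have hj : α j ≠ 0 := fun h0 => h (hf α h0)
    refine ⟨α - Pi.single j 1, ?_, ?_, sub_add_single hj⟩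
    · have h1 := (mem_piAntidiag.1 hα).1
      rw [← sub_add_single hj, sum_add_single] at h1
      rw [mem_piAntidiag]
      exact ⟨Nat.succ_injective h1, by simp⟩
    · rwa [sub_add_single hj]

section Entire

variable {c : (Fin m → ℕ) → ComplexClifford m}

/-- Multiplication by `z_j` raises the degree by one, which costs one factor `r` in the weighted
norm. -/
lemma hasSum_mulCoordCoeff_norm {r S C : ℝ} (hr : 0 ≤ r)
    (hC : ∀ (j : Fin m) (a : ComplexClifford m), ‖e j * a‖ ≤ C * ‖a‖) (j : Fin m)
    (h : HasSum (fun α => r ^ (∑ i, α i) * ‖c α‖) S) :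
    ∃ T ≤ C * r * S, HasSum (fun α => r ^ (∑ i, α i) * ‖mulCoordCoeff j c α‖) T := by
  have hinj := add_left_injective (Pi.single j 1 : Fin m → ℕ)
  have hle : ∀ α, r ^ (∑ i, α i + 1) * ‖e j * c α‖ ≤ C * r * (r ^ (∑ i, α i) * ‖c α‖) := by
    intro α
    have := mul_le_mul_of_nonneg_left (hC j (c α)) (pow_nonneg hr (∑ i, α i + 1))
    rw [pow_succ] at this ⊢
    linarith
  have hs : Summable fun α : Fin m → ℕ => r ^ (∑ i, α i + 1) * ‖e j * c α‖ :=
    Summable.of_nonneg_of_le (fun α => by positivity) hle (h.summable.mul_left _)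
  refine ⟨_, hasSum_le hle hs.hasSum (h.mul_left _), ?_⟩
  rw [← hinj.hasSum_iff]
  · simpa only [Function.comp_def, sum_add_single, mulCoordCoeff_add_single] using hs.hasSum
  · intro α hα
    rw [mulCoordCoeff_of_notMem hα, norm_zero, mul_zero]

/-- Multiplication by `z̲` is bounded for the weighted `ℓ¹` norms of the coefficients. -/
lemma exists_mulVecCoeff_bound (m : ℕ) : ∃ K : ℝ, 0 ≤ K ∧
    ∀ (c : (Fin m → ℕ) → ComplexClifford m) (r S : ℝ), 0 ≤ r →
      HasSum (fun α => r ^ (∑ i, α i) * ‖c α‖) S →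
      ∃ T ≤ K * r * S, HasSum (fun α => r ^ (∑ i, α i) * ‖mulVecCoeff c α‖) T := by
  obtain ⟨C₀, hC₀, hC⟩ := exists_norm_mul_le m
  set C : ℝ := ∑ j, C₀ * ‖(e j : ComplexClifford m)‖ with hCdef
  have hC1 : ∀ (j : Fin m) (a : ComplexClifford m), ‖e j * a‖ ≤ C * ‖a‖ := fun j a =>
    (hC _ _).trans (mul_le_mul_of_nonneg_right
      (Finset.single_le_sum (f := fun j => C₀ * ‖(e j : ComplexClifford m)‖)
        (fun _ _ => by positivity) (mem_univ j)) (norm_nonneg _))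
  refine ⟨m * C, by positivity, fun c r S hr h => ?_⟩
  choose T hT hT' using fun j => hasSum_mulCoordCoeff_norm hr hC1 j h
  have hsum := hasSum_sum (s := univ) fun j _ => hT' j
  have hle : ∀ α, r ^ (∑ i, α i) * ‖mulVecCoeff c α‖
      ≤ ∑ j, r ^ (∑ i, α i) * ‖mulCoordCoeff j c α‖ := fun α => by
    rw [← Finset.mul_sum]
    exact mul_le_mul_of_nonneg_left (norm_sum_le _ _) (by positivity)
  have hs : Summable fun α => r ^ (∑ i, α i) * ‖mulVecCoeff c α‖ :=
    Summable.of_nonneg_of_le (fun α => by positivity) hle hsum.summable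
  refine ⟨_, (hasSum_le hle hs.hasSum hsum).trans ?_, hs.hasSum⟩
  refine (Finset.sum_le_sum fun j _ => hT j).trans_eq ?_
  simp
  ring

lemma EntireCoeff.mulVecCoeff (hc : EntireCoeff c) : EntireCoeff (mulVecCoeff c) := fun r hr => by
  obtain ⟨K, -, h⟩ := exists_mulVecCoeff_bound m
  obtain ⟨T, -, hT⟩ := h c r _ hr (hc r hr).hasSum
  exact hT.summable

lemma EntireCoeff.hasSum_mulVecCoeff (hc : EntireCoeff c) (z : EuclideanSpace ℂ (Fin m)) :
    HasSum (fun α => monom z α • _root_.mulVecCoeff c α) (vec z * evalSeries c z) := by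
  simp only [_root_.mulVecCoeff, Finset.smul_sum, vec_mul]
  refine hasSum_sum fun j _ => ?_
  rw [← (add_left_injective (Pi.single j 1 : Fin m → ℕ)).hasSum_iff]
  · have h := ((mulCLM (e j)).hasSum (hc.hasSum z)).const_smul (z j)
    convert! h using 2 with α
    simp only [Function.comp_apply, mulCoordCoeff_add_single, map_smul, mulCLM_apply, smul_smul]
    congr 1
    rw [monom_eq z j, monom_eq z j α, ← mul_assoc, ← pow_succ']
    congr 1
    · simp
    · refine prod_congr rfl fun i hi => ?_
      simp [(mem_erase.1 hi).1]
  · intro α hα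
    rw [mulCoordCoeff_of_notMem hα, smul_zero]

lemma EntireCoeff.evalSeries_mulVecCoeff (hc : EntireCoeff c) (z : EuclideanSpace ℂ (Fin m)) :
    evalSeries (_root_.mulVecCoeff c) z = vec z * evalSeries c z :=
  (hc.hasSum_mulVecCoeff z).tsum_eq

lemma EntireCoeff.hasSum_mul_left (hc : EntireCoeff c) (a : ComplexClifford m)
    (z : EuclideanSpace ℂ (Fin m)) :
    HasSum (fun α => monom z α • (a * c α)) (a * evalSeries c z) := by
  simpa using (mulCLM a).hasSum (hc.hasSum z)

lemma EntireCoeff.dirac_evalSeries (hc : EntireCoeff c) (z : EuclideanSpace ℂ (Fin m)) :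
    dirac ℂ (evalSeries c) z = evalSeries (diracCoeff c) z := by
  have h : HasSum (fun α => monom z α • diracCoeff c α)
      (∑ j, e j * evalSeries (_root_.derivCoeff j c) z) := by
    simp only [diracCoeff, Finset.smul_sum]
    exact hasSum_sum fun j _ => (hc.derivCoeff j).hasSum_mul_left (e j) z
  rw [dirac, evalSeries, h.tsum_eq]
  simp only [hc.fderiv_single]

lemma EntireCoeff.dirac_real_evalSeries (hc : EntireCoeff c) (x : EuclideanSpace ℝ (Fin m)) :
    dirac ℝ (fun x => evalSeries c (realToComplex x)) x
      = evalSeries (diracCoeff c) (realToComplex x) := by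
  rw [← hc.dirac_evalSeries]
  simp only [dirac, hc.fderiv_single, hc.fderiv_real_single]

lemma EntireCoeff.add {V : Type*} [NormedAddCommGroup V] {c d : (Fin m → ℕ) → V}
    (hc : EntireCoeff c) (hd : EntireCoeff d) :
    EntireCoeff (c + d) := fun r hr =>
  Summable.of_nonneg_of_le (fun α => by positivity)
    (fun α => (mul_le_mul_of_nonneg_left (norm_add_le (c α) (d α)) (by positivity)).trans_eq
      (mul_add _ _ _)) ((hc r hr).add (hd r hr))

lemma EntireCoeff.sum {V ι : Type*} [NormedAddCommGroup V] (s : Finset ι)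
    {c : ι → (Fin m → ℕ) → V}
    (hc : ∀ i ∈ s, EntireCoeff (c i)) : EntireCoeff fun α => ∑ i ∈ s, c i α := fun r hr => by
  refine Summable.of_nonneg_of_le (fun α => by positivity)
    (fun α => mul_le_mul_of_nonneg_left (norm_sum_le s fun i => c i α) (by positivity)) ?_
  simp only [Finset.mul_sum]
  exact summable_sum fun i hi => hc i hi r hr

lemma EntireCoeff.mul_left (hc : EntireCoeff c) (a : ComplexClifford m) :
    EntireCoeff fun α => a * c α := fun r hr => by
  obtain ⟨C, -, hC⟩ := exists_norm_mul_le m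
  refine Summable.of_nonneg_of_le (fun α => by positivity) (fun α => ?_)
    ((hc r hr).mul_left (C * ‖a‖))
  exact (mul_le_mul_of_nonneg_left (hC _ _) (by positivity)).trans_eq (by ring)

lemma EntireCoeff.diracCoeff (hc : EntireCoeff c) : EntireCoeff (diracCoeff c) :=
  EntireCoeff.sum _ fun j _ => (hc.derivCoeff j).mul_left (e j)

end Entire

/-- The coefficients of homogeneous polynomials of degree `k`. -/
def homogCoeff (m k : ℕ) : Submodule ℝ ((Fin m → ℕ) → ComplexClifford m) where
  carrier := {c | ∀ α, ∑ j, α j ≠ k → c α = 0}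
  add_mem' hc hd α hα := by simp [hc α hα, hd α hα]
  zero_mem' _ _ := rfl
  smul_mem' r c hc α hα := by simp [hc α hα]

section Homog

variable {k : ℕ} {c : (Fin m → ℕ) → ComplexClifford m}

lemma entireCoeff_of_mem_homogCoeff (hc : c ∈ homogCoeff m k) : EntireCoeff c := fun r _ =>
  summable_of_ne_finset_zero (s := piAntidiag univ k) fun α hα => by
    rw [hc α (fun h => hα (by simp [h])), norm_zero, mul_zero]

lemma evalSeries_of_mem_homogCoeff (hc : c ∈ homogCoeff m k) :
    evalSeries c = homogPart k c := funext fun z =>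
  tsum_eq_sum fun α hα => by rw [hc α (fun h => hα (by simp [h])), smul_zero]

lemma isHomogPoly_evalSeries (hc : c ∈ homogCoeff m k) : IsHomogPoly k (evalSeries c) :=
  ⟨c, fun z => by rw [evalSeries_of_mem_homogCoeff hc]; rfl⟩

lemma IsHomogPoly.exists_evalSeries {P : EuclideanSpace ℂ (Fin m) → ComplexClifford m}
    (hP : IsHomogPoly k P) : ∃ c ∈ homogCoeff m k, P = evalSeries c := by
  obtain ⟨c, hc⟩ := hP
  have hmem : (fun α => if ∑ j, α j = k then c α else 0) ∈ homogCoeff m k :=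
    fun α hα => if_neg hα
  refine ⟨_, hmem, funext fun z => ?_⟩
  rw [evalSeries_of_mem_homogCoeff hmem, hc, homogPart]
  exact Finset.sum_congr rfl fun α hα => by rw [if_pos (mem_piAntidiag.1 hα).1]; rfl

lemma mulVecCoeff_mem_homogCoeff (hc : c ∈ homogCoeff m k) :
    mulVecCoeff c ∈ homogCoeff m (k + 1) := fun α hα => by
  refine Finset.sum_eq_zero fun j _ => ?_
  by_cases hj : α j = 0
  · simp [mulCoordCoeff, hj]
  · rw [← sub_add_single hj, mulCoordCoeff_add_single, hc, mul_zero]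
    intro h
    rw [← sub_add_single hj, sum_add_single, h] at hα
    exact hα rfl

lemma diracCoeff_mem_homogCoeff (hc : c ∈ homogCoeff m (k + 1)) :
    diracCoeff c ∈ homogCoeff m k := fun α hα => by
  refine Finset.sum_eq_zero fun j _ => ?_
  rw [derivCoeff, hc, smul_zero, mul_zero]
  rw [sum_add_single]
  omega

lemma diracCoeff_eq_zero_of_mem_homogCoeff_zero (hc : c ∈ homogCoeff m 0) :
    diracCoeff c = 0 := by
  funext α
  refine Finset.sum_eq_zero fun j _ => ?_
  rw [derivCoeff, hc, smul_zero, mul_zero]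
  rw [sum_add_single]
  omega

instance : FiniteDimensional ℝ (homogCoeff m k) := by
  have : FiniteDimensional ℝ (ComplexClifford m) := FiniteDimensional.complexToReal _
  let T : homogCoeff m k →ₗ[ℝ] (piAntidiag (univ : Finset (Fin m)) k → ComplexClifford m) :=
    { toFun := fun c α => c.1 α
      map_add' := fun _ _ => rfl
      map_smul' := fun _ _ => rfl }
  refine FiniteDimensional.of_injective T fun c d h => Subtype.ext (funext fun α => ?_)
  by_cases hα : ∑ j, α j = k
  · exact congrFun h ⟨α, by simp [hα]⟩
  · rw [c.2 α hα, d.2 α hα]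

end Homog

/-- Multiplication by `z̲` on coefficients, as a linear map. -/
def mulVecLin (m : ℕ) :
    ((Fin m → ℕ) → ComplexClifford m) →ₗ[ℝ] ((Fin m → ℕ) → ComplexClifford m) where
  toFun := mulVecCoeff
  map_add' c d := by
    funext α
    simp only [mulVecCoeff, Pi.add_apply, ← Finset.sum_add_distrib]
    refine Finset.sum_congr rfl fun j _ => ?_
    by_cases h : α j = 0 <;> simp [mulCoordCoeff, h, mul_add]
  map_smul' r c := by
    funext α
    simp only [mulVecCoeff, Pi.smul_apply, Finset.smul_sum, RingHom.id_apply]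
    refine Finset.sum_congr rfl fun j _ => ?_
    by_cases h : α j = 0 <;> simp [mulCoordCoeff, h]

/-- The Dirac operator on coefficients, as a linear map. -/
def diracLin (m : ℕ) :
    ((Fin m → ℕ) → ComplexClifford m) →ₗ[ℝ] ((Fin m → ℕ) → ComplexClifford m) where
  toFun := diracCoeff
  map_add' c d := by
    funext α
    simp only [diracCoeff, derivCoeff, Pi.add_apply, ← Finset.sum_add_distrib, smul_add, mul_add]
  map_smul' r c := by
    funext α
    simp only [diracCoeff, derivCoeff, Pi.smul_apply, Finset.smul_sum, RingHom.id_apply]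
    refine Finset.sum_congr rfl fun j _ => ?_
    rw [smul_comm, mul_smul_comm]

/-- The real Fischer form in degree `k`, built on a form `Q` on the Clifford algebra. -/
def fischerForm (Q : ComplexClifford m →ₗ[ℝ] ComplexClifford m →ₗ[ℝ] ℝ) (k : ℕ) :
    ((Fin m → ℕ) → ComplexClifford m) →ₗ[ℝ] ((Fin m → ℕ) → ComplexClifford m) →ₗ[ℝ] ℝ :=
  ∑ α ∈ piAntidiag univ k, ((∏ j, (α j).factorial : ℕ) : ℝ) •
    Q.compl₁₂ (LinearMap.proj α) (LinearMap.proj α)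

lemma fischerForm_apply (Q : ComplexClifford m →ₗ[ℝ] ComplexClifford m →ₗ[ℝ] ℝ) (k : ℕ)
    (c d : (Fin m → ℕ) → ComplexClifford m) :
    fischerForm Q k c d
      = ∑ α ∈ piAntidiag univ k, ((∏ j, (α j).factorial : ℕ) : ℝ) * Q (c α) (d α) := by
  simp [fischerForm, LinearMap.sum_apply]

lemma prod_factorial_add_single (α : Fin m → ℕ) (j : Fin m) :
    ∏ i, ((α + Pi.single j 1 : Fin m → ℕ) i).factorial = (α j + 1) * ∏ i, (α i).factorial := by
  rw [← Finset.mul_prod_erase _ _ (mem_univ j), ← Finset.mul_prod_erase univ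
    (fun i => (α i).factorial) (mem_univ j), ← mul_assoc]
  congr 1
  · simp [Nat.factorial_succ]
  · exact prod_congr rfl fun i hi => by simp [(mem_erase.1 hi).1]

/-! ### The Fischer form -/

section Form

variable {Q : ComplexClifford m →ₗ[ℝ] ComplexClifford m →ₗ[ℝ] ℝ}

/-- For the Fischer form, multiplication by `z̲` is adjoint to `-∂_z̲`. -/
lemma fischerForm_mulVecCoeff (hQ : ∀ j a b, Q (e j * a) b = -Q a (e j * b)) (k : ℕ)
    (c d : (Fin m → ℕ) → ComplexClifford m) :
    fischerForm Q (k + 1) (mulVecCoeff c) d = -fischerForm Q k c (diracCoeff d) := by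
  simp only [fischerForm_apply, mulVecCoeff, diracCoeff, map_sum, LinearMap.sum_apply,
    Finset.mul_sum]
  rw [Finset.sum_comm, Finset.sum_comm (s := piAntidiag univ k), ← Finset.sum_neg_distrib]
  refine Finset.sum_congr rfl fun j _ => ?_
  -- After the shift `α ↦ α + e_j` both sides agree term by term: `(α + e_j)! = (α_j + 1) α!`
  -- supplies the factor produced by differentiation, and the skewness of `e_j` supplies the sign.
  rw [sum_piAntidiag_succ j k _ (fun α hα => by simp [mulCoordCoeff, hα]),
    ← Finset.sum_neg_distrib]
  refine Finset.sum_congr rfl fun α _ => ?_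
  rw [mulCoordCoeff_add_single, hQ, prod_factorial_add_single, derivCoeff, mul_smul_comm,
    ← Complex.ofReal_natCast, Complex.coe_smul, map_smul]
  push_cast
  simp only [smul_eq_mul]
  ring

lemma fischerForm_symm (hQ : ∀ a b, Q a b = Q b a) (k : ℕ)
    (c d : (Fin m → ℕ) → ComplexClifford m) : fischerForm Q k c d = fischerForm Q k d c := by
  simp only [fischerForm_apply, hQ]

lemma sum_norm_sq_le_fischerForm (hQ : ∀ a, ‖a‖ ^ 2 ≤ Q a a) (k : ℕ)
    (c : (Fin m → ℕ) → ComplexClifford m) :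
    ∑ α ∈ piAntidiag univ k, ((∏ j, (α j).factorial : ℕ) : ℝ) * ‖c α‖ ^ 2
      ≤ fischerForm Q k c c := by
  rw [fischerForm_apply]
  exact Finset.sum_le_sum fun α _ => mul_le_mul_of_nonneg_left (hQ _) (Nat.cast_nonneg _)

lemma fischerForm_self_nonneg (hQ : ∀ a, ‖a‖ ^ 2 ≤ Q a a) (k : ℕ)
    (c : (Fin m → ℕ) → ComplexClifford m) : 0 ≤ fischerForm Q k c c :=
  (Finset.sum_nonneg fun α _ => by positivity).trans (sum_norm_sq_le_fischerForm hQ k c)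

lemma eq_zero_of_fischerForm_self (hQ : ∀ a, ‖a‖ ^ 2 ≤ Q a a) {k : ℕ}
    {c : (Fin m → ℕ) → ComplexClifford m} (hc : c ∈ homogCoeff m k)
    (h : fischerForm Q k c c = 0) : c = 0 := by
  have h1 := (sum_norm_sq_le_fischerForm hQ k c).trans_eq h
  have h2 := (Finset.sum_eq_zero_iff_of_nonneg fun α _ => by positivity).1
    (h1.antisymm (Finset.sum_nonneg fun α _ => by positivity))
  funext α
  by_cases hα : ∑ j, α j = k
  · have h3 := h2 α (by simp [hα])
    have h4 : ((∏ j, (α j).factorial : ℕ) : ℝ) ≠ 0 :=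
      Nat.cast_ne_zero.2 (prod_ne_zero_iff.2 fun j _ => Nat.factorial_ne_zero _)
    rcases mul_eq_zero.1 h3 with h | h
    · exact absurd h h4
    · simpa using h
  · exact hc α hα

end Form

/-- Definiteness passes to `U`, so the restricted form is nondegenerate and `U` is complementary to
its orthogonal space. -/
lemma exists_orthogonal_decomposition {W : Type*} [AddCommGroup W] [Module ℝ W]
    [FiniteDimensional ℝ W] (b : W →ₗ[ℝ] W →ₗ[ℝ] ℝ) (hs : ∀ x y, b x y = b y x)
    (hp : ∀ x, b x x = 0 → x = 0) (U : Submodule ℝ W) (w : W) :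
    ∃ u ∈ U, ∀ v ∈ U, b v (w - u) = 0 := by
  have hrefl : LinearMap.BilinForm.IsRefl b := fun x y h => by rw [hs]; exact h
  have hnd : (LinearMap.BilinForm.restrict b U).Nondegenerate :=
    ⟨fun x hx => Subtype.ext (hp _ (hx x)), fun x hx => Subtype.ext (hp _ (hx x))⟩
  have h := LinearMap.BilinForm.isCompl_orthogonal_of_restrict_nondegenerate hrefl hnd
  obtain ⟨u, hu, v, hv, huv⟩ := Submodule.mem_sup.1
    (h.sup_eq_top ▸ Submodule.mem_top : w ∈ U ⊔ LinearMap.BilinForm.orthogonal b U)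
  refine ⟨u, hu, fun x hx => ?_⟩
  rw [← huv, add_sub_cancel_left]
  exact hv x hx

/-- The Fischer decomposition, on coefficients. -/
lemma exists_fischer_decomposition {Q : ComplexClifford m →ₗ[ℝ] ComplexClifford m →ₗ[ℝ] ℝ}
    (hQs : ∀ a b, Q a b = Q b a) (hQp : ∀ a, ‖a‖ ^ 2 ≤ Q a a)
    (hQ : ∀ j a b, Q (e j * a) b = -Q a (e j * b)) {k : ℕ}
    {c : (Fin m → ℕ) → ComplexClifford m} (hc : c ∈ homogCoeff m k) :
    ∃ μ ∈ homogCoeff m k, ∃ s, ((k = 0 ∧ s = 0) ∨ ∃ j, k = j + 1 ∧ s ∈ homogCoeff m j) ∧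
      c = μ + mulVecCoeff s ∧ diracCoeff μ = 0 ∧ fischerForm Q k μ μ ≤ fischerForm Q k c c := by
  obtain _ | k := k
  · refine ⟨c, hc, 0, Or.inl ⟨rfl, rfl⟩, ?_, diracCoeff_eq_zero_of_mem_homogCoeff_zero hc, le_rfl⟩
    rw [show mulVecCoeff (0 : (Fin m → ℕ) → ComplexClifford m) = 0 from (mulVecLin m).map_zero,
      add_zero]
  · let b : homogCoeff m (k + 1) →ₗ[ℝ] homogCoeff m (k + 1) →ₗ[ℝ] ℝ :=
      (fischerForm Q (k + 1)).compl₁₂ (homogCoeff m (k + 1)).subtype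
        (homogCoeff m (k + 1)).subtype
    have hb : ∀ x y, b x y = fischerForm Q (k + 1) x.1 y.1 := fun _ _ => rfl
    -- `u` is the orthogonal projection of `c` onto the multiples of `z̲`; the monogenic part will
    -- be `c - u`.
    obtain ⟨u, hu, huv⟩ := exists_orthogonal_decomposition b
      (fun x y => fischerForm_symm hQs _ _ _)
      (fun x hx => Subtype.ext (eq_zero_of_fischerForm_self hQp x.2 hx))
      (((homogCoeff m k).map (mulVecLin m)).comap (homogCoeff m (k + 1)).subtype) ⟨c, hc⟩
    obtain ⟨s, hs, hsu⟩ := hu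
    have hsu' : mulVecCoeff s = u.1 := hsu
    have horth : ∀ t ∈ homogCoeff m k, fischerForm Q (k + 1) (mulVecCoeff t) (c - u.1) = 0 :=
      fun t ht => huv ⟨mulVecCoeff t, mulVecCoeff_mem_homogCoeff ht⟩ ⟨t, ht, rfl⟩
    have hμ : c - u.1 ∈ homogCoeff m (k + 1) := Submodule.sub_mem _ hc u.2
    refine ⟨c - u.1, hμ, s, Or.inr ⟨k, rfl, hs⟩, ?_, ?_, ?_⟩
    · rw [hsu', sub_add_cancel]
    -- Testing `μ = c - u` against `z̲ (∂_z̲ μ)` gives `[∂_z̲ μ, ∂_z̲ μ] = 0` by adjointness.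
    · have hd := diracCoeff_mem_homogCoeff hμ
      refine eq_zero_of_fischerForm_self hQp hd ?_
      rw [← neg_eq_zero, ← fischerForm_mulVecCoeff hQ]
      exact horth _ hd
    -- Pythagoras: `[c, c] = [μ, μ] + [u, u]`.
    · have h1 := horth s hs
      rw [hsu'] at h1
      have h2 : fischerForm Q (k + 1) c c = fischerForm Q (k + 1) (c - u.1) (c - u.1)
          + fischerForm Q (k + 1) u.1 u.1 := by
        have h3 : c = (c - u.1) + u.1 := (sub_add_cancel _ _).symm
        conv_lhs => rw [h3]
        rw [map_add, map_add, LinearMap.add_apply, LinearMap.add_apply, h1,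
          fischerForm_symm hQs _ (c - u.1) u.1, h1]
        ring
      linarith [fischerForm_self_nonneg hQp (k + 1) u.1]

/-- The Fischer decomposition is unique, on coefficients. -/
lemma eq_zero_of_eq_mulVecCoeff {k : ℕ} {c s : (Fin m → ℕ) → ComplexClifford m}
    (hc : c ∈ homogCoeff m k) (hd : diracCoeff c = 0)
    (hs : (k = 0 ∧ s = 0) ∨ ∃ j, k = j + 1) (h : c = mulVecCoeff s) : c = 0 := by
  obtain ⟨Q, hQs, hQp, hQ⟩ := exists_invariant_form m
  obtain ⟨-, rfl⟩ | ⟨j, rfl⟩ := hs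
  · exact h.trans (mulVecLin m).map_zero
  · refine eq_zero_of_fischerForm_self hQp hc ?_
    -- `[c, c] = [z̲ s, c] = -[s, ∂_z̲ c] = 0`.
    nth_rewrite 1 [h]
    rw [fischerForm_mulVecCoeff hQ, hd, map_zero, neg_zero]

lemma sum_piAntidiag_norm_monom_sq (z : EuclideanSpace ℂ (Fin m)) (k : ℕ) :
    ∑ α ∈ piAntidiag univ k, ‖monom z α‖ ^ 2 / ((∏ j, (α j).factorial : ℕ) : ℝ)
      = (‖z‖ ^ k) ^ 2 / k.factorial := by
  rw [← pow_mul, mul_comm k, pow_mul, EuclideanSpace.norm_sq_eq,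
    ← sum_piAntidiag_prod_div_factorial]
  refine Finset.sum_congr rfl fun α _ => ?_
  rw [Finset.prod_div_distrib]
  push_cast
  congr 1
  rw [monom, norm_prod, ← Finset.prod_pow]
  exact prod_congr rfl fun j _ => by rw [norm_pow, ← pow_mul, ← pow_mul, mul_comm]

/-- The pointwise estimate for homogeneous polynomials by their Fischer norm. -/
lemma norm_homogPart_sq_le (k : ℕ) (c : (Fin m → ℕ) → ComplexClifford m)
    (z : EuclideanSpace ℂ (Fin m)) :
    ‖homogPart k c z‖ ^ 2 ≤ (‖z‖ ^ k) ^ 2 / k.factorial *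
      ∑ α ∈ piAntidiag univ k, ((∏ j, (α j).factorial : ℕ) : ℝ) * ‖c α‖ ^ 2 := by
  rw [← sum_piAntidiag_norm_monom_sq]
  have h1 : ‖homogPart k c z‖ ≤ ∑ α ∈ piAntidiag univ k, ‖monom z α‖ * ‖c α‖ :=
    (norm_sum_le _ _).trans_eq (Finset.sum_congr rfl fun α _ => norm_smul _ _)
  refine (pow_le_pow_left₀ (norm_nonneg _) h1 2).trans ?_
  -- Cauchy–Schwarz with weights `1 / α!` on the monomials and `α!` on the coefficients.
  refine Finset.sum_sq_le_sum_mul_sum_of_sq_le_mul _ (fun α _ => by positivity)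
    (fun α _ => by positivity) fun α _ => ?_
  have h4 : ((∏ j, (α j).factorial : ℕ) : ℝ) ≠ 0 :=
    Nat.cast_ne_zero.2 (prod_ne_zero_iff.2 fun j _ => Nat.factorial_ne_zero _)
  exact (by field_simp : _ = _).le

end Fischer
end

noncomputable section

open Finset ComplexClifford

/-! ### Monogenic parts of monomials, polynomials and entire functions -/

section MonogenicPart

variable {m : ℕ}

lemma single_mem_homogCoeff (α : Fin m → ℕ) (a : ComplexClifford m) :
    Pi.single α a ∈ homogCoeff m (∑ j, α j) := fun β hβ => by
  rw [Pi.single_apply, if_neg]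
  rintro rfl
  exact hβ rfl

/-- With `k = |α|`, the squared Fischer norm of `z^α` is `α! Q(1, 1) ≤ k! Q(1, 1)`, and projecting
does not increase it. The pointwise estimate divides by `k!`, so `C = √(Q 1 1)` works for all `α` at
once. -/
lemma exists_monogenicMonomial (m : ℕ) : ∃ (C : ℝ)
    (μ s : (Fin m → ℕ) → (Fin m → ℕ) → ComplexClifford m), 0 ≤ C ∧ ∀ α,
      μ α ∈ homogCoeff m (∑ j, α j) ∧ diracCoeff (μ α) = 0 ∧
      ((∑ j, α j = 0 ∧ s α = 0) ∨ ∃ k, ∑ j, α j = k + 1 ∧ s α ∈ homogCoeff m k) ∧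
      Pi.single α 1 = μ α + mulVecCoeff (s α) ∧
      ∀ z, ‖evalSeries (μ α) z‖ ≤ C * ‖z‖ ^ ∑ j, α j := by
  obtain ⟨Q, hQs, hQp, hQ⟩ := exists_invariant_form m
  choose μ h1 s h2 h3 h4 h5 using fun α : Fin m → ℕ =>
    exists_fischer_decomposition hQs hQp hQ (single_mem_homogCoeff α 1)
  refine ⟨√(Q 1 1), μ, s, Real.sqrt_nonneg _, fun α =>
    ⟨h1 α, h4 α, h2 α, h3 α, fun z => ?_⟩⟩
  set k := ∑ j, α j with hk
  have hQ1 : 0 ≤ Q 1 1 := (sq_nonneg _).trans (hQp 1)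
  have h6 : fischerForm Q k (Pi.single α 1) (Pi.single α 1)
      = ((∏ j, (α j).factorial : ℕ) : ℝ) * Q 1 1 := by
    rw [fischerForm_apply, Finset.sum_eq_single α]
    · simp
    · intro β _ hβ
      simp [hβ]
    · intro h
      exact absurd (by simp [hk]) h
  have h7 : ((∏ j, (α j).factorial : ℕ) : ℝ) ≤ k.factorial := by
    exact_mod_cast Nat.le_of_dvd (Nat.factorial_pos _) (Nat.prod_factorial_dvd_factorial_sum _ _)
  have h8 := (sum_norm_sq_le_fischerForm hQp k (μ α)).trans (h5 α)
  rw [h6] at h8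
  rw [evalSeries_of_mem_homogCoeff (h1 α)]
  refine le_of_sq_le_sq ?_ (by positivity)
  refine (norm_homogPart_sq_le k (μ α) z).trans ?_
  rw [mul_pow, Real.sq_sqrt hQ1]
  have hkf : (0 : ℝ) < k.factorial := Nat.cast_pos.2 (Nat.factorial_pos _)
  calc (‖z‖ ^ k) ^ 2 / k.factorial *
        ∑ β ∈ piAntidiag univ k, ((∏ j, (β j).factorial : ℕ) : ℝ) * ‖μ α β‖ ^ 2
      ≤ (‖z‖ ^ k) ^ 2 / k.factorial * (k.factorial * Q 1 1) :=
        mul_le_mul_of_nonneg_left (h8.trans (mul_le_mul_of_nonneg_right h7 hQ1)) (by positivity)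
    _ = Q 1 1 * (‖z‖ ^ k) ^ 2 := by field_simp

/-- The coefficients of the monogenic part of `z^α`. -/
def monogenicMonomialCoeff (α : Fin m → ℕ) : (Fin m → ℕ) → ComplexClifford m :=
  (exists_monogenicMonomial m).choose_spec.choose α

/-- The monogenic part of the monomial `z^α`. -/
def monogenicMonomial (α : Fin m → ℕ) (z : EuclideanSpace ℂ (Fin m)) : ComplexClifford m :=
  evalSeries (monogenicMonomialCoeff α) z

lemma exists_norm_monogenicMonomial_le (m : ℕ) : ∃ C : ℝ, 0 ≤ C ∧
    ∀ (α : Fin m → ℕ) z, ‖monogenicMonomial α z‖ ≤ C * ‖z‖ ^ ∑ j, α j := by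
  obtain ⟨s, hC, h⟩ := (exists_monogenicMonomial m).choose_spec.choose_spec
  exact ⟨_, hC, fun α => (h α).2.2.2.2⟩

lemma monogenicMonomialCoeff_spec (α : Fin m → ℕ) :
    monogenicMonomialCoeff α ∈ homogCoeff m (∑ j, α j) ∧
    diracCoeff (monogenicMonomialCoeff α) = 0 ∧ ∃ s : (Fin m → ℕ) → ComplexClifford m,
      ((∑ j, α j = 0 ∧ s = 0) ∨ ∃ k, ∑ j, α j = k + 1 ∧ s ∈ homogCoeff m k) ∧
      Pi.single α 1 = monogenicMonomialCoeff α + mulVecCoeff s := by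
  obtain ⟨s, -, h⟩ := (exists_monogenicMonomial m).choose_spec.choose_spec
  exact ⟨(h α).1, (h α).2.1, s α, (h α).2.2.1, (h α).2.2.2.1⟩

lemma monogenicMonomialCoeff_mem {k : ℕ} {α : Fin m → ℕ} (hα : α ∈ piAntidiag univ k) :
    monogenicMonomialCoeff α ∈ homogCoeff m k := by
  rw [← (mem_piAntidiag.1 hα).1]
  exact (monogenicMonomialCoeff_spec α).1

variable {k : ℕ} {c : (Fin m → ℕ) → ComplexClifford m}

lemma sum_mul_mem_homogCoeff {ι : Type*} (s : Finset ι)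
    {d : ι → (Fin m → ℕ) → ComplexClifford m}
    (hd : ∀ i ∈ s, d i ∈ homogCoeff m k) (a : ι → ComplexClifford m) :
    (fun β => ∑ i ∈ s, d i β * a i) ∈ homogCoeff m k := fun β hβ =>
  Finset.sum_eq_zero fun i hi => by rw [hd i hi β hβ, zero_mul]

lemma evalSeries_sum_mul {ι : Type*} (s : Finset ι)
    {d : ι → (Fin m → ℕ) → ComplexClifford m}
    (hd : ∀ i ∈ s, EntireCoeff (d i)) (a : ι → ComplexClifford m)
    (z : EuclideanSpace ℂ (Fin m)) :
    evalSeries (fun β => ∑ i ∈ s, d i β * a i) z = ∑ i ∈ s, evalSeries (d i) z * a i := by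
  refine HasSum.tsum_eq ?_
  simp only [Finset.smul_sum]
  refine hasSum_sum fun i hi => ?_
  simpa only [ContinuousLinearMap.flip_apply, mulCLM_apply, smul_mul_assoc] using
    (mulCLM.flip (a i)).hasSum ((hd i hi).hasSum z)

lemma diracCoeff_sum_mul {ι : Type*} (s : Finset ι)
    {d : ι → (Fin m → ℕ) → ComplexClifford m}
    (hd : ∀ i ∈ s, diracCoeff (d i) = 0) (a : ι → ComplexClifford m) :
    diracCoeff (fun β => ∑ i ∈ s, d i β * a i) = 0 := by
  funext β
  have : ∀ i ∈ s, diracCoeff (d i) β * a i = 0 := fun i hi => by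
    rw [hd i hi, Pi.zero_apply, zero_mul]
  rw [Pi.zero_apply, ← Finset.sum_eq_zero this]
  simp only [diracCoeff, derivCoeff, Finset.smul_sum, Finset.mul_sum, Finset.sum_mul]
  rw [Finset.sum_comm]
  simp only [smul_mul_assoc, mul_smul_comm, mul_assoc]

lemma isComplexMonogenic_evalSeries (hc : EntireCoeff c) (hd : diracCoeff c = 0) :
    IsComplexMonogenic (evalSeries c) := by
  refine ⟨hc.differentiable, fun z => ?_⟩
  rw [hc.dirac_evalSeries, hd]
  simp [evalSeries]

/-- The monogenic part of a homogeneous polynomial, by monomials. -/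
lemma isHomogMonogenicPart_homogPart (k : ℕ) (c : (Fin m → ℕ) → ComplexClifford m) :
    IsHomogMonogenicPart k (homogPart k c)
      (fun z => ∑ α ∈ piAntidiag univ k, monogenicMonomial α z * c α) := by
  -- `z̲` and `∂_z̲` act from the left, so the decomposition of each `z^α` may be multiplied by `c
  -- α` on the right and summed.
  have hμ := fun α (hα : α ∈ piAntidiag (univ : Finset (Fin m)) k) =>
    monogenicMonomialCoeff_mem hα
  have hM : (fun z => ∑ α ∈ piAntidiag univ k, monogenicMonomial α z * c α)
      = evalSeries fun β => ∑ α ∈ piAntidiag univ k, monogenicMonomialCoeff α β * c α :=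
    funext fun z =>
      (evalSeries_sum_mul _ (fun α hα => entireCoeff_of_mem_homogCoeff (hμ α hα)) c z).symm
  have hmem := sum_mul_mem_homogCoeff _ hμ c
  choose s hs hs' using fun α : Fin m → ℕ => (monogenicMonomialCoeff_spec α).2.2
  have hsE : ∀ α ∈ piAntidiag (univ : Finset (Fin m)) k, EntireCoeff (s α) := fun α hα => by
    rcases hs α with ⟨-, h⟩ | ⟨j, -, h⟩
    · rw [h]
      exact fun r _ => by simp
    · exact entireCoeff_of_mem_homogCoeff h
  refine ⟨hM ▸ isHomogPoly_evalSeries hmem, hM ▸ isComplexMonogenic_evalSeries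
    (entireCoeff_of_mem_homogCoeff hmem)
    (diracCoeff_sum_mul _ (fun α _ => (monogenicMonomialCoeff_spec α).2.1) c),
    evalSeries fun β => ∑ α ∈ piAntidiag univ k, s α β * c α, ?_, fun z => ?_⟩
  · obtain _ | k := k
    · refine Or.inl ⟨rfl, ?_⟩
      have h0 : (fun β => ∑ α ∈ piAntidiag univ 0, s α β * c α) = 0 := by
        funext β
        refine Finset.sum_eq_zero fun α hα => ?_
        have hα' : ∑ j, α j = 0 := (mem_piAntidiag.1 hα).1
        rcases hs α with ⟨-, h⟩ | ⟨j, hj, -⟩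
        · rw [h, Pi.zero_apply, zero_mul]
        · omega
      rw [h0]
      funext z
      simp [evalSeries]
    · refine Or.inr ⟨k, rfl, isHomogPoly_evalSeries (sum_mul_mem_homogCoeff _ ?_ c)⟩
      intro α hα
      have hα' : ∑ j, α j = k + 1 := (mem_piAntidiag.1 hα).1
      rcases hs α with ⟨h, -⟩ | ⟨j, hj, h⟩
      · omega
      · obtain rfl : j = k := by omega
        exact h
  · rw [evalSeries_sum_mul _ hsE, Finset.mul_sum, ← Finset.sum_add_distrib]
    refine Finset.sum_congr rfl fun α hα => ?_
    rw [← mul_assoc, ← add_mul, ← (hsE α hα).evalSeries_mulVecCoeff, monogenicMonomial]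
    have hE := entireCoeff_of_mem_homogCoeff (hμ α hα)
    have h1 := (hE.hasSum z).add ((hsE α hα).mulVecCoeff.hasSum z)
    simp only [← smul_add] at h1
    have h2 : HasSum (fun β => monom z β • (Pi.single α 1 : (Fin m → ℕ) → ComplexClifford m) β)
        (monom z α • 1) := by
      convert! hasSum_single (f := fun β => monom z β •
        (Pi.single α 1 : (Fin m → ℕ) → ComplexClifford m) β) α ?_ using 1
      · simp
      · intro β hβ
        simp [hβ]
    rw [hs' α] at h2
    rw [h1.unique h2, smul_mul_assoc, one_mul]

/-- On coefficients, the difference of two monogenic parts is both monogenic and a multiple of `z̲`,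
hence Fischer-orthogonal to itself. -/
lemma IsHomogMonogenicPart.eq {R M M' : EuclideanSpace ℂ (Fin m) → ComplexClifford m}
    (h : IsHomogMonogenicPart k R M) (h' : IsHomogMonogenicPart k R M') : M = M' := by
  have key : ∀ {M : EuclideanSpace ℂ (Fin m) → ComplexClifford m},
      IsHomogMonogenicPart k R M → ∃ d s : (Fin m → ℕ) → ComplexClifford m,
        d ∈ homogCoeff m k ∧ diracCoeff d = 0 ∧ EntireCoeff s ∧ M = evalSeries d ∧
        ((k = 0 ∧ s = 0) ∨ ∃ j, k = j + 1) ∧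
        ∀ z, R z = evalSeries (d + mulVecCoeff s) z := by
    rintro M ⟨hM1, hM2, S, hS, hR⟩
    obtain ⟨d, hd, rfl⟩ := hM1.exists_evalSeries
    have hdE := entireCoeff_of_mem_homogCoeff hd
    have hd0 : diracCoeff d = 0 := by
      refine hdE.diracCoeff.ext_real (d := 0) (fun r _ => by simp)
        fun x => ?_
      rw [← hdE.dirac_evalSeries, hM2.2]
      simp [evalSeries]
    have hfin : ∀ s : (Fin m → ℕ) → ComplexClifford m, EntireCoeff s → S = evalSeries s →
        ∀ z, R z = evalSeries (d + mulVecCoeff s) z := by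
      rintro s hs rfl z
      rw [hR, ← hs.evalSeries_mulVecCoeff]
      have h1 := (hdE.hasSum z).add (hs.mulVecCoeff.hasSum z)
      simp only [← smul_add] at h1
      exact h1.tsum_eq.symm
    rcases hS with ⟨hk, hS⟩ | ⟨j, hj, hS⟩
    · have h0 : EntireCoeff (0 : (Fin m → ℕ) → ComplexClifford m) :=
        fun r _ => by simp
      exact ⟨d, 0, hd, hd0, h0, rfl, Or.inl ⟨hk, rfl⟩, hfin 0 h0
        (hS.trans (funext fun z => by simp [evalSeries]))⟩
    · obtain ⟨s, hs, hs'⟩ := hS.exists_evalSeries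
      have hsE := entireCoeff_of_mem_homogCoeff hs
      exact ⟨d, s, hd, hd0, hsE, rfl, Or.inr ⟨j, hj⟩, hfin s hsE hs'⟩
  obtain ⟨d, s, h1, h2, h3, rfl, h5, h6⟩ := key h
  obtain ⟨d', s', h1', h2', h3', rfl, h5', h6'⟩ := key h'
  have heq : d + mulVecCoeff s = d' + mulVecCoeff s' :=
    ((entireCoeff_of_mem_homogCoeff h1).add h3.mulVecCoeff).ext_real
      ((entireCoeff_of_mem_homogCoeff h1').add h3'.mulVecCoeff) fun x => by rw [← h6, ← h6']
  have hsub : d - d' = mulVecCoeff (s' - s) := by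
    rw [show mulVecCoeff (s' - s) = mulVecCoeff s' - mulVecCoeff s from (mulVecLin m).map_sub _ _,
      sub_eq_sub_iff_add_eq_add, heq, add_comm]
  have hd : diracCoeff (d - d') = 0 := by
    rw [show diracCoeff (d - d') = diracCoeff d - diracCoeff d' from (diracLin m).map_sub _ _,
      h2, h2', sub_zero]
  have hk : (k = 0 ∧ s' - s = 0) ∨ ∃ j, k = j + 1 := by
    rcases h5 with ⟨hk, rfl⟩ | h
    · rcases h5' with ⟨-, rfl⟩ | h
      · exact Or.inl ⟨hk, sub_zero _⟩
      · exact Or.inr h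
    · exact Or.inr h
  rw [sub_eq_zero.1 (eq_zero_of_eq_mulVecCoeff (Submodule.sub_mem _ h1 h1') hd hk hsub)]

lemma HasMonogenicPart.eq {F G G' : EuclideanSpace ℂ (Fin m) → ComplexClifford m}
    (h : HasMonogenicPart F G) (h' : HasMonogenicPart F G') : G = G' := by
  obtain ⟨-, M, hM, hG⟩ := h
  obtain ⟨-, M', hM', hG'⟩ := h'
  obtain rfl : M = M' := funext fun k => (hM k).eq (hM' k)
  exact funext fun z => (hG z).unique (hG' z)

lemma HasMonogenicPart.monogenicPart_eq
    {F G : EuclideanSpace ℂ (Fin m) → ComplexClifford m} (h : HasMonogenicPart F G) :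
    monogenicPart F = G := by
  have hex : ∃ G, HasMonogenicPart F G := ⟨G, h⟩
  rw [monogenicPart, dif_pos hex]
  exact hex.choose_spec.eq h

/-- The bound on `monogenicMonomial` is uniform in `α`, so the series is dominated by the one in
`EntireCoeff` at `r = ‖z‖`. -/
lemma EntireCoeff.summable_monogenicMonomial_mul (hc : EntireCoeff c)
    (z : EuclideanSpace ℂ (Fin m)) : Summable fun α => monogenicMonomial α z * c α := by
  obtain ⟨C, hC, hle⟩ := exists_norm_monogenicMonomial_le m
  obtain ⟨K, hK, hKle⟩ := exists_norm_mul_le m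
  refine Summable.of_norm_bounded ((hc ‖z‖ (norm_nonneg _)).mul_left (K * C)) fun α => ?_
  refine (hKle _ _).trans ?_
  have := mul_le_mul_of_nonneg_right (mul_le_mul_of_nonneg_left (hle α z) hK) (norm_nonneg (c α))
  linarith

/-- The monogenic part of an entire power series is computed monomial by monomial. -/
lemma EntireCoeff.hasMonogenicPart (hc : EntireCoeff c) :
    HasMonogenicPart (evalSeries c) (fun z => ∑' α, monogenicMonomial α z * c α) := by
  refine ⟨hc.differentiable, fun k z => ∑ α ∈ piAntidiag univ k, monogenicMonomial α z * c α,
    fun k => ?_, fun z => (hc.summable_monogenicMonomial_mul z).hasSum.sum_piAntidiag⟩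
  rw [taylorPart_evalSeries hc]
  exact isHomogMonogenicPart_homogPart k c

lemma IsHomogMonogenicPart.self {M : EuclideanSpace ℂ (Fin m) → ComplexClifford m}
    (h : IsHomogPoly k M) (h' : IsComplexMonogenic M) : IsHomogMonogenicPart k M M := by
  refine ⟨h, h', 0, ?_, fun z => by simp⟩
  obtain _ | k := k
  · exact Or.inl ⟨rfl, rfl⟩
  · exact Or.inr ⟨k, rfl, 0, fun z => by simp⟩

lemma homogPart_eq_evalSeries (k : ℕ) (c : (Fin m → ℕ) → ComplexClifford m) :
    (fun α => if ∑ j, α j = k then c α else 0) ∈ homogCoeff m k ∧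
      homogPart k c = evalSeries fun α => if ∑ j, α j = k then c α else 0 := by
  have hmem : (fun α => if ∑ j, α j = k then c α else 0) ∈ homogCoeff m k :=
    fun α hα => if_neg hα
  refine ⟨hmem, funext fun z => ?_⟩
  rw [evalSeries_of_mem_homogCoeff hmem, homogPart, homogPart]
  exact Finset.sum_congr rfl fun α hα => by rw [if_pos (mem_piAntidiag.1 hα).1]

/-- The Dirac operator lowers the degree by exactly one, so it annihilates each homogeneous part
separately; each part is then its own monogenic part. -/
lemma EntireCoeff.hasMonogenicPart_self (hc : EntireCoeff c) (hd : _root_.diracCoeff c = 0) :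
    HasMonogenicPart (evalSeries c) (evalSeries c) := by
  refine ⟨hc.differentiable, fun k => homogPart k c, fun k => ?_, hc.hasSum_homogPart⟩
  rw [taylorPart_evalSeries hc]
  obtain ⟨hmem, heq⟩ := homogPart_eq_evalSeries k c
  show IsHomogMonogenicPart k (homogPart k c) (homogPart k c)
  rw [heq]
  refine IsHomogMonogenicPart.self (isHomogPoly_evalSeries hmem)
    (isComplexMonogenic_evalSeries (entireCoeff_of_mem_homogCoeff hmem) (funext fun α => ?_))
  have h0 : _root_.diracCoeff c α = 0 := congrFun hd α
  simp only [_root_.diracCoeff, _root_.derivCoeff, sum_add_single] at h0 ⊢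
  by_cases h : ∑ i, α i + 1 = k
  · simpa [h] using h0
  · simp [h]

/-- The monogenic part of `z̲ F` vanishes. -/
lemma EntireCoeff.tsum_monogenicMonomial_mulVecCoeff (hc : EntireCoeff c)
    (z : EuclideanSpace ℂ (Fin m)) :
    ∑' α, monogenicMonomial α z * _root_.mulVecCoeff c α = 0 := by
  have h := (hc.mulVecCoeff.summable_monogenicMonomial_mul z).hasSum.sum_piAntidiag
  refine h.unique ?_
  convert! hasSum_zero (α := ComplexClifford m) (β := ℕ) using 2 with k
  -- The degree `k` part of `z̲ F` is `z̲` times the degree `k - 1` part of `F` (and `0` for `k =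
  -- 0`). This is a Fischer decomposition with monogenic part `0`, and uniqueness applies.
  refine congrFun ((isHomogMonogenicPart_homogPart k (_root_.mulVecCoeff c)).eq
    (M' := fun _ => 0) ⟨⟨0, fun z => by simp⟩, ⟨by fun_prop, fun z => by simp [dirac]⟩, ?_⟩) z
  obtain _ | k := k
  · refine ⟨0, Or.inl ⟨rfl, rfl⟩, fun z => ?_⟩
    simp only [homogPart, Pi.zero_apply, mul_zero, add_zero]
    refine Finset.sum_eq_zero fun α hα => ?_
    rw [_root_.mulVecCoeff, Finset.sum_eq_zero, smul_zero]
    intro j _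
    have : α j = 0 := Finset.sum_eq_zero_iff.1 (mem_piAntidiag.1 hα).1 j (mem_univ j)
    simp [mulCoordCoeff, this]
  · refine ⟨homogPart k c, Or.inr ⟨k, rfl, c, fun z => rfl⟩, fun z => ?_⟩
    obtain ⟨hmem, heq⟩ := homogPart_eq_evalSeries k c
    rw [heq, ← (entireCoeff_of_mem_homogCoeff hmem).evalSeries_mulVecCoeff,
      evalSeries_of_mem_homogCoeff (mulVecCoeff_mem_homogCoeff hmem), zero_add]
    refine Finset.sum_congr rfl fun α hα => ?_
    congr 1
    refine Finset.sum_congr rfl fun j _ => ?_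
    by_cases hj : α j = 0
    · simp [mulCoordCoeff, hj]
    · rw [← sub_add_single hj, mulCoordCoeff_add_single, mulCoordCoeff_add_single, if_pos]
      have h1 := (mem_piAntidiag.1 hα).1
      rw [← sub_add_single hj, sum_add_single] at h1
      exact Nat.succ_injective h1

end MonogenicPart
end

noncomputable section

open Finset ComplexClifford

/-! ### Exponential moments, and termwise integration of the kernel -/

section Moments

variable {m : ℕ}

/-- The divided power `x^α / α!`. -/
def dividedPower (x : EuclideanSpace ℝ (Fin m)) (α : Fin m → ℕ) : ℝ :=
  ∏ j, (x j ^ α j / ((α j).factorial : ℝ))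

/-- The moment `∫ x^α / α! w(x) dx`. -/
def moment (w : EuclideanSpace ℝ (Fin m) → ComplexClifford m) (α : Fin m → ℕ) :
    ComplexClifford m :=
  ∫ x, dividedPower x α • w x

/-- `w` decays faster than every exponential, in the mean. -/
def HasExpDecay (w : EuclideanSpace ℝ (Fin m) → ComplexClifford m) : Prop :=
  AEStronglyMeasurable w volume ∧
    ∀ r : ℝ, 0 ≤ r → Integrable (fun x => Real.exp (r * ∑ j, |x j|) * ‖w x‖) volume

lemma hasSum_pow_mul_abs_dividedPower {r : ℝ} (hr : 0 ≤ r) (x : EuclideanSpace ℝ (Fin m)) :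
    HasSum (fun α => r ^ (∑ j, α j) * |dividedPower x α|) (Real.exp (r * ∑ j, |x j|)) := by
  have h0 : ∀ j, 0 ≤ r * |x j| := fun j => by positivity
  have h := (summable_prod_div_factorial h0).hasSum
  rw [tsum_prod_div_factorial h0, ← Finset.mul_sum] at h
  convert! h using 2 with α
  rw [dividedPower, Finset.abs_prod, ← Finset.prod_pow_eq_pow_sum, ← Finset.prod_mul_distrib]
  refine prod_congr rfl fun j _ => ?_
  rw [abs_div, abs_pow, Nat.abs_cast, mul_pow, mul_div_assoc]

lemma continuous_dividedPower (α : Fin m → ℕ) :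
    Continuous fun x : EuclideanSpace ℝ (Fin m) => dividedPower x α := by
  unfold dividedPower
  fun_prop

variable {w : EuclideanSpace ℝ (Fin m) → ComplexClifford m}

lemma HasExpDecay.integrable_dividedPower_mul_norm (hw : HasExpDecay w) {r : ℝ} (hr : 0 ≤ r)
    (s : Finset (Fin m → ℕ)) :
    Integrable (fun x => (∑ α ∈ s, r ^ (∑ j, α j) * |dividedPower x α|) * ‖w x‖) volume := by
  refine (hw.2 r hr).mono' ?_ (Filter.Eventually.of_forall fun x => ?_)
  · refine AEStronglyMeasurable.mul ?_ hw.1.norm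
    have hcont := fun α => continuous_dividedPower (m := m) α
    exact (by fun_prop : Continuous fun x : EuclideanSpace ℝ (Fin m) =>
      ∑ α ∈ s, r ^ (∑ j, α j) * |dividedPower x α|).aestronglyMeasurable
  · have hs := hasSum_pow_mul_abs_dividedPower hr x
    rw [Real.norm_of_nonneg (mul_nonneg (sum_nonneg fun α _ => by positivity) (norm_nonneg _))]
    exact mul_le_mul_of_nonneg_right (sum_le_hasSum s (fun α _ => by positivity) hs)
      (norm_nonneg _)

lemma HasExpDecay.integrable_dividedPower (hw : HasExpDecay w) (α : Fin m → ℕ) :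
    Integrable (fun x => dividedPower x α • w x) volume := by
  refine (hw.integrable_dividedPower_mul_norm zero_le_one {α}).mono'
    ((continuous_dividedPower α).aestronglyMeasurable.smul hw.1)
    (Filter.Eventually.of_forall fun x => ?_)
  simp [norm_smul]

/-- Every finite partial sum of `∑ r ^ |α| |x^α / α!|` is at most `exp (r ∑ |x_j|)`, whose integral
against `‖w‖` is finite. -/
lemma HasExpDecay.summable_integral (hw : HasExpDecay w) {r : ℝ} (hr : 0 ≤ r) :
    Summable fun α => r ^ (∑ j, α j) * ∫ x, ‖dividedPower x α • w x‖ := by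
  refine summable_of_sum_le (c := ∫ x, Real.exp (r * ∑ j, |x j|) * ‖w x‖)
    (fun α => mul_nonneg (by positivity) (integral_nonneg fun x => norm_nonneg _)) fun s => ?_
  simp only [← integral_const_mul]
  rw [← integral_finsetSum]
  · refine integral_mono ?_ (hw.2 r hr) fun x => ?_
    · exact integrable_finsetSum _ fun α _ => (hw.integrable_dividedPower α).norm.const_mul _
    · have hs := hasSum_pow_mul_abs_dividedPower hr x
      simp only [norm_smul, Real.norm_eq_abs, ← mul_assoc, ← Finset.sum_mul]
      exact mul_le_mul_of_nonneg_right (sum_le_hasSum s (fun α _ => by positivity) hs)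
        (norm_nonneg _)
  · exact fun α _ => (hw.integrable_dividedPower α).norm.const_mul _

lemma HasExpDecay.entireCoeff_moment (hw : HasExpDecay w) : EntireCoeff (moment w) :=
  fun r hr => Summable.of_nonneg_of_le (fun α => by positivity)
    (fun α => mul_le_mul_of_nonneg_left (norm_integral_le_integral_norm _) (by positivity))
    (hw.summable_integral hr)

/-- Termwise integration against an exponentially bounded series of divided powers. -/
lemma HasExpDecay.hasSum_moment (hw : HasExpDecay w)
    (L : (Fin m → ℕ) → ComplexClifford m →L[ℂ] ComplexClifford m) {C a : ℝ} (ha : 0 ≤ a)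
    (hL : ∀ α v, ‖L α v‖ ≤ C * a ^ (∑ j, α j) * ‖v‖) :
    HasSum (fun α => L α (moment w α)) (∫ x, ∑' α, L α (dividedPower x α • w x)) := by
  have hint := fun α => (L α).integrable_comp (hw.integrable_dividedPower α)
  have h := hasSum_integral_of_summable_integral_norm hint ?_
  · simp only [fun α => (L α).integral_comp_comm (hw.integrable_dividedPower α)] at h
    exact h
  · refine Summable.of_nonneg_of_le (fun α => integral_nonneg fun x => norm_nonneg _)
      (fun α => ?_) ((hw.summable_integral ha).mul_left C)
    rw [← mul_assoc, ← integral_const_mul]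
    exact integral_mono (hint α).norm ((hw.integrable_dividedPower α).norm.const_mul _)
      fun x => hL α _

lemma hasSum_monom_mul_dividedPower (z : EuclideanSpace ℂ (Fin m))
    (x : EuclideanSpace ℝ (Fin m)) :
    HasSum (fun α => monom z α * (dividedPower x α : ℂ))
      (Complex.exp (cdot z (realToComplex x))) := by
  have h := hasSum_prod_div_factorial fun j => z j * (x j : ℂ)
  convert! h using 2 with α
  rw [monom, dividedPower]
  push_cast
  rw [← Finset.prod_mul_distrib]
  refine prod_congr rfl fun j _ => ?_
  rw [mul_pow, mul_div_assoc]

/-- Expand `e^{z·x}` in divided powers of `x` and integrate termwise. -/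
lemma HasExpDecay.evalSeries_moment (hw : HasExpDecay w) (z : EuclideanSpace ℂ (Fin m)) :
    evalSeries (moment w) z = ∫ x, Complex.exp (cdot z (realToComplex x)) • w x := by
  have h := hw.hasSum_moment (fun α => monom z α • ContinuousLinearMap.id ℂ _) (C := 1)
    (norm_nonneg z) (fun α v => by
      rw [one_mul]
      show ‖monom z α • v‖ ≤ _
      rw [norm_smul]
      exact mul_le_mul_of_nonneg_right (norm_monom_le z (fun j => PiLp.norm_apply_le z j) α)
        (norm_nonneg _))
  refine h.tsum_eq.trans (integral_congr_ae (Filter.Eventually.of_forall fun x => ?_))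
  refine HasSum.tsum_eq ?_
  convert! (hasSum_monom_mul_dividedPower z x).smul_const (w x) using 2 with α
  rw [mul_smul, Complex.coe_smul]
  rfl

/-! ### The Fourier-Borel kernel -/

lemma entireCoeff_mul_inv_factorial {c : (Fin m → ℕ) → ComplexClifford m} {C a : ℝ}
    (ha : 0 ≤ a) (hc : ∀ α, ‖c α‖ ≤ C * a ^ ∑ j, α j) :
    EntireCoeff fun α => ((∏ j, ((α j).factorial : ℂ))⁻¹) • c α := fun r hr => by
  have h := (summable_prod_div_factorial (m := m) (x := fun _ => r * a)
    (fun _ => by positivity)).mul_left C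
  refine Summable.of_nonneg_of_le (fun α => by positivity) (fun α => ?_) h
  rw [norm_smul, norm_inv, norm_prod]
  simp only [Complex.norm_natCast]
  rw [Finset.prod_div_distrib, Finset.prod_pow_eq_pow_sum, mul_pow]
  have := mul_le_mul_of_nonneg_left (hc α)
    (by positivity : 0 ≤ r ^ (∑ j, α j) * (∏ j, ((α j).factorial : ℝ))⁻¹)
  rw [← mul_assoc]
  refine this.trans_eq ?_
  field_simp

/-- The coefficients of the Fourier-Borel kernel in the second variable. -/
def kernelCoeff (z : EuclideanSpace ℂ (Fin m)) (α : Fin m → ℕ) : ComplexClifford m :=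
  ((∏ j, ((α j).factorial : ℂ))⁻¹) • monogenicMonomial α z

lemma entireCoeff_kernelCoeff (z : EuclideanSpace ℂ (Fin m)) : EntireCoeff (kernelCoeff z) := by
  obtain ⟨C, -, hC⟩ := exists_norm_monogenicMonomial_le m
  exact entireCoeff_mul_inv_factorial (norm_nonneg z) fun α => hC α z

/-- The coefficients of `e^{⟨z, u⟩}`. -/
def expCoeff (u : EuclideanSpace ℝ (Fin m)) (α : Fin m → ℕ) : ComplexClifford m :=
  (dividedPower u α : ℂ) • 1

lemma monom_realToComplex (u : EuclideanSpace ℝ (Fin m)) (α : Fin m → ℕ) :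
    monom (realToComplex u) α = (∏ j, ((α j).factorial : ℂ)) * (dividedPower u α : ℂ) := by
  rw [monom, dividedPower]
  push_cast
  rw [← Finset.prod_mul_distrib]
  refine prod_congr rfl fun j _ => ?_
  have : ((α j).factorial : ℂ) ≠ 0 := Nat.cast_ne_zero.2 (Nat.factorial_ne_zero _)
  rw [mul_div_cancel₀ _ this]
  rfl

lemma prod_factorial_ne_zero (α : Fin m → ℕ) : (∏ j, ((α j).factorial : ℂ)) ≠ 0 :=
  prod_ne_zero_iff.2 fun _ _ => Nat.cast_ne_zero.2 (Nat.factorial_ne_zero _)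

lemma entireCoeff_expCoeff (u : EuclideanSpace ℝ (Fin m)) : EntireCoeff (expCoeff u) := by
  intro r hr
  refine (((hasSum_pow_mul_abs_dividedPower hr u).summable).mul_right
    ‖(1 : ComplexClifford m)‖).congr fun α => ?_
  rw [expCoeff, norm_smul, Complex.norm_real, Real.norm_eq_abs, mul_assoc]

lemma evalSeries_expCoeff (u : EuclideanSpace ℝ (Fin m)) :
    evalSeries (expCoeff u) = expPairing u := funext fun z => by
  refine HasSum.tsum_eq ?_
  convert! (hasSum_monom_mul_dividedPower z u).smul_const (1 : ComplexClifford m) using 2 with α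
  rw [mul_smul, expCoeff]

lemma monom_smul_kernelCoeff (z : EuclideanSpace ℂ (Fin m)) (u : EuclideanSpace ℝ (Fin m))
    (α : Fin m → ℕ) :
    monom (realToComplex u) α • kernelCoeff z α = dividedPower u α • monogenicMonomial α z := by
  rw [monom_realToComplex, kernelCoeff, smul_smul, mul_right_comm,
    mul_inv_cancel₀ (prod_factorial_ne_zero α), one_mul, Complex.coe_smul]

/-- The coefficient of `z^α` in `e^{z·u}` is `u^α / α!`, so the monogenic part is `∑ (u^α / α!)
M_α(z)`. Read as a power series in `u`, it has coefficients `kernelCoeff z`, which makes the kernel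
analytic in its second variable. -/
lemma hasMonogenicPart_expPairing (u : EuclideanSpace ℝ (Fin m)) :
    HasMonogenicPart (expPairing u) fun z => evalSeries (kernelCoeff z) (realToComplex u) := by
  rw [← evalSeries_expCoeff]
  convert! (entireCoeff_expCoeff u).hasMonogenicPart using 2 with z
  refine tsum_congr fun α => ?_
  rw [monom_smul_kernelCoeff, expCoeff, mul_smul_comm, mul_one, Complex.coe_smul]

lemma fourierBorelKernel_eq (z : EuclideanSpace ℂ (Fin m)) (u : EuclideanSpace ℝ (Fin m)) :
    fourierBorelKernel z u = evalSeries (kernelCoeff z) (realToComplex u) := by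
  rw [fourierBorelKernel, (hasMonogenicPart_expPairing u).monogenicPart_eq]

/-- The growth in `u` is of the form allowed by `HasExpDecay`. -/
lemma exists_norm_fourierBorelKernel_le (m : ℕ) : ∃ C : ℝ, 0 ≤ C ∧
    ∀ (z : EuclideanSpace ℂ (Fin m)) u,
      ‖fourierBorelKernel z u‖ ≤ C * Real.exp (‖z‖ * ∑ j, |u j|) := by
  obtain ⟨C, hC, hle⟩ := exists_norm_monogenicMonomial_le m
  refine ⟨C, hC, fun z u => ?_⟩
  rw [fourierBorelKernel_eq]
  refine tsum_of_norm_bounded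
    ((hasSum_pow_mul_abs_dividedPower (norm_nonneg z) u).mul_left C) fun α => ?_
  rw [monom_smul_kernelCoeff, norm_smul, Real.norm_eq_abs]
  have := mul_le_mul_of_nonneg_left (hle α z) (abs_nonneg (dividedPower u α))
  linarith

lemma continuous_fourierBorelKernel (z : EuclideanSpace ℂ (Fin m)) :
    Continuous fun u => fourierBorelKernel z u := by
  simp only [fourierBorelKernel_eq]
  exact continuous_iff_continuousAt.2 fun u =>
    ((entireCoeff_kernelCoeff z).hasFDerivAt_real u).continuousAt

lemma HasExpDecay.integrable_kernel (hw : HasExpDecay w) (z : EuclideanSpace ℂ (Fin m)) :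
    Integrable (fun x => fourierBorelKernel z x * w x) volume := by
  obtain ⟨C, hC, hle⟩ := exists_norm_fourierBorelKernel_le m
  obtain ⟨K, hK, hKle⟩ := exists_norm_mul_le m
  refine ((hw.2 ‖z‖ (norm_nonneg _)).const_mul (K * C)).mono' ?_
    (Filter.Eventually.of_forall fun x => ?_)
  · exact mulCLM.aestronglyMeasurable_comp₂
      (continuous_fourierBorelKernel z).aestronglyMeasurable hw.1
  · refine (hKle _ _).trans ?_
    have := mul_le_mul_of_nonneg_right (mul_le_mul_of_nonneg_left (hle z x) hK)
      (norm_nonneg (w x))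
    linarith

/-- The same termwise integration as for `e^{z·x}`, with `M_α(z)` in place of `z^α`: the integrated
series is now that of the kernel. -/
lemma HasExpDecay.tsum_monogenicMonomial_moment (hw : HasExpDecay w)
    (z : EuclideanSpace ℂ (Fin m)) :
    ∑' α, monogenicMonomial α z * moment w α = ∫ x, fourierBorelKernel z x * w x := by
  obtain ⟨C, hC, hle⟩ := exists_norm_monogenicMonomial_le m
  obtain ⟨K, hK, hKle⟩ := exists_norm_mul_le m
  have h := hw.hasSum_moment (fun α => mulCLM (monogenicMonomial α z)) (C := K * C)
    (norm_nonneg z) (fun α v => by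
      refine (hKle _ _).trans ?_
      have := mul_le_mul_of_nonneg_right (mul_le_mul_of_nonneg_left (hle α z) hK)
        (norm_nonneg v)
      linarith)
  refine h.tsum_eq.trans (integral_congr_ae (Filter.Eventually.of_forall fun x => ?_))
  refine HasSum.tsum_eq ?_
  have h1 := (mulCLM.flip (w x)).hasSum
    ((entireCoeff_kernelCoeff z).hasSum (realToComplex x))
  simp only [monom_smul_kernelCoeff, ← fourierBorelKernel_eq, ContinuousLinearMap.flip_apply,
    mulCLM_apply] at h1
  convert! h1 using 2 with α
  rw [mulCLM_apply, mul_smul_comm, smul_mul_assoc]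

end Moments

/-! ### The factor `e^{-z·z/2}` does not affect the monogenic part -/

section GaussianFactor

variable {m : ℕ} {c : (Fin m → ℕ) → ComplexClifford m}

lemma iterate_mulVecCoeff_bound {K : ℝ} (hK : 0 ≤ K)
    (h : ∀ (c : (Fin m → ℕ) → ComplexClifford m) (r S : ℝ), 0 ≤ r →
      HasSum (fun α => r ^ (∑ i, α i) * ‖c α‖) S →
      ∃ T ≤ K * r * S, HasSum (fun α => r ^ (∑ i, α i) * ‖mulVecCoeff c α‖) T)
    {r S : ℝ} (hr : 0 ≤ r) (hc : HasSum (fun α => r ^ (∑ i, α i) * ‖c α‖) S) (n : ℕ) :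
    ∃ T ≤ (K * r) ^ n * S, HasSum (fun α => r ^ (∑ i, α i) * ‖mulVecCoeff^[n] c α‖) T := by
  induction n with
  | zero => exact ⟨S, by simp, hc⟩
  | succ n ih =>
    obtain ⟨T, hT, hT'⟩ := ih
    obtain ⟨T', h1, h2⟩ := h _ r T hr hT'
    refine ⟨T', h1.trans ?_, by simpa only [Function.iterate_succ_apply'] using h2⟩
    exact (mul_le_mul_of_nonneg_left hT (mul_nonneg hK hr)).trans_eq (by ring)

lemma EntireCoeff.iterate_mulVecCoeff (hc : EntireCoeff c) (n : ℕ) :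
    EntireCoeff (_root_.mulVecCoeff^[n] c) := by
  induction n with
  | zero => exact hc
  | succ n ih => simpa only [Function.iterate_succ_apply'] using ih.mulVecCoeff

/-- The coefficients of `e^{-z·z/2} F = ∑_i (z̲²/2)^i F / i!`, if `c` are those of `F`. -/
def gaussianCoeff (c : (Fin m → ℕ) → ComplexClifford m) (α : Fin m → ℕ) : ComplexClifford m :=
  ∑' i : ℕ, (((2 : ℂ) ^ i * i.factorial)⁻¹) • mulVecCoeff^[2 * i] c α

lemma summable_mul_of_hasSum {β : Type*} {a T : ℕ → ℝ} {N : ℕ → β → ℝ} (ha : ∀ i, 0 ≤ a i)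
    (hN : ∀ i b, 0 ≤ N i b) (hT : ∀ i, HasSum (N i) (T i)) (h : Summable fun i => a i * T i) :
    Summable fun p : ℕ × β => a p.1 * N p.1 p.2 := by
  have h1 : ∀ i, HasSum (fun b => a i * N i b) (a i * T i) := fun i => (hT i).mul_left (a i)
  have h2 : 0 ≤ fun p : ℕ × β => a p.1 * N p.1 p.2 := fun p => mul_nonneg (ha _) (hN _ _)
  rw [summable_prod_of_nonneg h2]
  refine ⟨fun i => (h1 i).summable, ?_⟩
  simpa only [fun i => (h1 i).tsum_eq] using h

/-- Multiplying `2 i` times by `z̲` costs `(K r) ^ (2 i)`, which the denominators `2 ^ i i!` turn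
into the exponential series at `(K r)² / 2`. -/
lemma EntireCoeff.summable_gaussian (hc : EntireCoeff c) {r : ℝ} (hr : 0 ≤ r) :
    Summable fun p : ℕ × (Fin m → ℕ) => ((2 : ℝ) ^ p.1 * p.1.factorial)⁻¹ *
      (r ^ (∑ j, p.2 j) * ‖_root_.mulVecCoeff^[2 * p.1] c p.2‖) := by
  obtain ⟨K, hK, h⟩ := exists_mulVecCoeff_bound m
  obtain ⟨S, hS⟩ := hc r hr
  choose T hT hT' using fun n => iterate_mulVecCoeff_bound hK h hr hS n
  have hT0 : ∀ n, 0 ≤ T n := fun n => (hT' n).nonneg fun α => by positivity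
  refine summable_mul_of_hasSum (a := fun i : ℕ => ((2 : ℝ) ^ i * i.factorial)⁻¹)
    (N := fun i α => r ^ (∑ j, α j) * ‖_root_.mulVecCoeff^[2 * i] c α‖)
    (fun i => by positivity) (fun i α => by positivity) (fun i => hT' (2 * i)) ?_
  refine Summable.of_nonneg_of_le (fun i => mul_nonneg (by positivity) (hT0 _)) (fun i => ?_)
    ((Real.summable_pow_div_factorial ((K * r) ^ 2 / 2)).mul_right S)
  refine (mul_le_mul_of_nonneg_left (hT (2 * i)) (by positivity)).trans_eq ?_
  rw [pow_mul, div_pow, mul_inv, div_div, div_eq_mul_inv, mul_inv]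
  ring

lemma EntireCoeff.gaussianCoeff (hc : EntireCoeff c) : EntireCoeff (gaussianCoeff c) := by
  intro r hr
  have h := (hc.summable_gaussian hr).prod_symm.prod
  have h1 : ∀ α, Summable fun i : ℕ => ((2 : ℝ) ^ i * i.factorial)⁻¹ *
      (r ^ (∑ j, α j) * ‖_root_.mulVecCoeff^[2 * i] c α‖) := fun α =>
    (hc.summable_gaussian hr).prod_symm.prod_factor α
  refine Summable.of_nonneg_of_le (fun α => by positivity) (fun α => ?_) h
  have h2 := tsum_of_norm_bounded (f := fun i : ℕ => ((r ^ (∑ j, α j) : ℝ) : ℂ) •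
    (((2 : ℂ) ^ i * i.factorial)⁻¹) • _root_.mulVecCoeff^[2 * i] c α) (h1 α).hasSum fun i => by
      rw [norm_smul, norm_smul, Complex.norm_real, Real.norm_of_nonneg (by positivity)]
      simp only [norm_inv, norm_mul, norm_pow, Complex.norm_ofNat, Complex.norm_natCast]
      exact (by ring : _ = _).le
  rw [tsum_const_smul'', norm_smul, Complex.norm_real, Real.norm_of_nonneg (by positivity)] at h2
  exact h2

/-- Exponentially bounded functionals may be applied to `gaussianCoeff` termwise. -/
lemma EntireCoeff.tsum_gaussianCoeff (hc : EntireCoeff c)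
    (L : (Fin m → ℕ) → ComplexClifford m →L[ℂ] ComplexClifford m) {C a : ℝ} (ha : 0 ≤ a)
    (hL : ∀ α v, ‖L α v‖ ≤ C * a ^ (∑ j, α j) * ‖v‖) :
    ∑' α, L α (_root_.gaussianCoeff c α) = ∑' i : ℕ, (((2 : ℂ) ^ i * i.factorial)⁻¹) •
      ∑' α, L α (_root_.mulVecCoeff^[2 * i] c α) := by
  have h : Summable fun p : ℕ × (Fin m → ℕ) => (((2 : ℂ) ^ p.1 * p.1.factorial)⁻¹) •
      L p.2 (_root_.mulVecCoeff^[2 * p.1] c p.2) := by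
    refine Summable.of_norm_bounded ((hc.summable_gaussian ha).mul_left C) fun p => ?_
    rw [norm_smul]
    simp only [norm_inv, norm_mul, norm_pow, Complex.norm_ofNat, Complex.norm_natCast]
    have := mul_le_mul_of_nonneg_left (hL p.2 (_root_.mulVecCoeff^[2 * p.1] c p.2))
      (by positivity : 0 ≤ ((2 : ℝ) ^ p.1 * p.1.factorial)⁻¹)
    linarith
  have h1 : ∀ α, Summable fun i : ℕ => (((2 : ℂ) ^ i * i.factorial)⁻¹) •
      _root_.mulVecCoeff^[2 * i] c α := fun α => by
    refine Summable.of_norm_bounded ((hc.summable_gaussian zero_le_one).prod_symm.prod_factor α)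
      fun i => ?_
    rw [norm_smul]
    simp
  have h2 := Summable.tsum_comm (f := fun (i : ℕ) (α : Fin m → ℕ) =>
    (((2 : ℂ) ^ i * i.factorial)⁻¹) • L α (_root_.mulVecCoeff^[2 * i] c α)) h
  simp only [tsum_const_smul''] at h2
  rw [← h2]
  refine tsum_congr fun α => ?_
  rw [_root_.gaussianCoeff, (L α).map_tsum (h1 α)]
  simp only [map_smul]

lemma evalSeries_iterate_mulVecCoeff (hc : EntireCoeff c) (z : EuclideanSpace ℂ (Fin m))
    (i : ℕ) : evalSeries (mulVecCoeff^[2 * i] c) z = (-cdot z z) ^ i • evalSeries c z := by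
  induction i with
  | zero => simp
  | succ i ih =>
    have h1 := hc.iterate_mulVecCoeff (2 * i)
    rw [show 2 * (i + 1) = 2 * i + 1 + 1 by ring, Function.iterate_succ_apply',
      Function.iterate_succ_apply', h1.mulVecCoeff.evalSeries_mulVecCoeff,
      h1.evalSeries_mulVecCoeff, vec_mul_vec_mul, ih, smul_smul, ← neg_smul, pow_succ', neg_mul]

lemma EntireCoeff.evalSeries_gaussianCoeff (hc : EntireCoeff c) (z : EuclideanSpace ℂ (Fin m)) :
    evalSeries (_root_.gaussianCoeff c) z = Complex.exp (-cdot z z / 2) • evalSeries c z := by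
  have h := hc.tsum_gaussianCoeff (fun α => monom z α • ContinuousLinearMap.id ℂ _) (C := 1)
    (norm_nonneg z) (fun α v => by
      rw [one_mul]
      show ‖monom z α • v‖ ≤ _
      rw [norm_smul]
      exact mul_le_mul_of_nonneg_right (norm_monom_le z (fun j => PiLp.norm_apply_le z j) α)
        (norm_nonneg _))
  refine h.trans ?_
  have h1 : ∀ i : ℕ, ∑' α, (monom z α • ContinuousLinearMap.id ℂ (ComplexClifford m))
      (_root_.mulVecCoeff^[2 * i] c α) = (-cdot z z) ^ i • evalSeries c z := fun i =>
    evalSeries_iterate_mulVecCoeff hc z i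
  simp only [h1, smul_smul]
  refine HasSum.tsum_eq ?_
  have h2 := NormedSpace.expSeries_div_hasSum_exp (-cdot z z / 2)
  rw [← Complex.exp_eq_exp_ℂ] at h2
  convert! h2.smul_const (evalSeries c z) using 3 with i
  rw [div_pow]
  field_simp

/-- Each term with `i ≥ 1` is `z̲` times an entire function and has monogenic part zero; only `i =
0` survives. -/
lemma EntireCoeff.tsum_monogenicMonomial_gaussianCoeff (hc : EntireCoeff c)
    (z : EuclideanSpace ℂ (Fin m)) :
    ∑' α, monogenicMonomial α z * _root_.gaussianCoeff c α
      = ∑' α, monogenicMonomial α z * c α := by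
  obtain ⟨C, hC, hle⟩ := exists_norm_monogenicMonomial_le m
  obtain ⟨K, hK, hKle⟩ := exists_norm_mul_le m
  have h := hc.tsum_gaussianCoeff (fun α => mulCLM (monogenicMonomial α z)) (C := K * C)
    (norm_nonneg z) (fun α v => by
      refine (hKle _ _).trans ?_
      have := mul_le_mul_of_nonneg_right (mul_le_mul_of_nonneg_left (hle α z) hK)
        (norm_nonneg v)
      linarith)
  simp only [mulCLM_apply] at h
  rw [h, tsum_eq_single 0]
  · simp
  · intro i hi
    obtain ⟨n, hn⟩ : ∃ n, 2 * i = n + 1 := ⟨2 * i - 1, by omega⟩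
    rw [hn]
    simp only [Function.iterate_succ_apply']
    rw [(hc.iterate_mulVecCoeff n).tsum_monogenicMonomial_mulVecCoeff, smul_zero]

end GaussianFactor
end

noncomputable section

open Finset ComplexClifford

/-! ### Radial mean values, and the harmonic case -/

section MeanValue

variable {m : ℕ} {V : Type*} [NormedAddCommGroup V] [NormedSpace ℝ V]
  {g : EuclideanSpace ℝ (Fin m) → V}

lemma eq_zero_of_lt_norm {η : ℝ → ℝ} {R : ℝ} (hR : ∀ s, R ≤ s → η s = 0)
    (x : EuclideanSpace ℝ (Fin m)) (hx : x ∉ Metric.closedBall 0 (|R| + 1)) :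
    η (‖x‖ ^ 2) = 0 := by
  rw [mem_closedBall_zero_iff, not_le] at hx
  have h1 := abs_nonneg R
  exact hR _ (by nlinarith [le_abs_self R])

lemma integrable_radial_smul {η : ℝ → ℝ} (hη : Continuous η) {R : ℝ}
    (hR : ∀ s, R ≤ s → η s = 0) {F : EuclideanSpace ℝ (Fin m) → V} (hF : Continuous F) :
    Integrable (fun x => η (‖x‖ ^ 2) • F x) volume := by
  refine Continuous.integrable_of_hasCompactSupport (by fun_prop) ?_
  refine HasCompactSupport.intro (isCompact_closedBall 0 (|R| + 1)) fun x hx => ?_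
  rw [eq_zero_of_lt_norm hR x hx, zero_smul]

/-- Differentiation of spherical averages with respect to the dilation. -/
lemma hasDerivAt_integral_radial {η : ℝ → ℝ} (hη : Continuous η) {R : ℝ}
    (hR : ∀ s, R ≤ s → η s = 0) (hg : ContDiff ℝ 1 g) (z : EuclideanSpace ℝ (Fin m)) (t : ℝ) :
    HasDerivAt (fun t : ℝ => ∫ x, η (‖x‖ ^ 2) • g (z + t • x))
      (∫ x, η (‖x‖ ^ 2) • fderiv ℝ g (z + t • x) x) t := by
  have hg0 := hg.continuous
  have hg1 : Continuous (fderiv ℝ g) := hg.continuous_fderiv one_ne_zero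
  have hcont : Continuous fun p : ℝ × EuclideanSpace ℝ (Fin m) =>
      η (‖p.2‖ ^ 2) • fderiv ℝ g (z + p.1 • p.2) p.2 := by
    refine Continuous.smul (by fun_prop) ?_
    exact (hg1.comp (by fun_prop)).clm_apply (by fun_prop)
  obtain ⟨C, hC⟩ := ((isCompact_closedBall t 1).prod
    (isCompact_closedBall (0 : EuclideanSpace ℝ (Fin m)) (|R| + 1))).exists_bound_of_continuousOn
    hcont.continuousOn
  refine (hasDerivAt_integral_of_dominated_loc_of_deriv_le (μ := volume)
    (F := fun t x => η (‖x‖ ^ 2) • g (z + t • x))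
    (F' := fun t x => η (‖x‖ ^ 2) • fderiv ℝ g (z + t • x) x)
    (bound := (Metric.closedBall (0 : EuclideanSpace ℝ (Fin m)) (|R| + 1)).indicator fun _ => C)
    (Metric.ball_mem_nhds t one_pos) ?_ ?_ ?_ ?_ ?_ ?_).2
  · refine Filter.Eventually.of_forall fun s => Continuous.aestronglyMeasurable ?_
    fun_prop
  · exact integrable_radial_smul hη hR (by fun_prop)
  · exact (hcont.comp (by fun_prop : Continuous fun x => (t, x))).aestronglyMeasurable
  · refine Filter.Eventually.of_forall fun x s hs => ?_
    by_cases hx : x ∈ Metric.closedBall (0 : EuclideanSpace ℝ (Fin m)) (|R| + 1)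
    · rw [Set.indicator_of_mem hx]
      exact hC (s, x) ⟨Metric.ball_subset_closedBall hs, hx⟩
    · rw [Set.indicator_of_notMem hx, eq_zero_of_lt_norm hR x hx, zero_smul, norm_zero]
  · exact (integrable_indicator_iff measurableSet_closedBall).2
      (integrableOn_const measure_closedBall_lt_top.ne)
  · refine Filter.Eventually.of_forall fun x s _ => ?_
    have h1 : HasDerivAt (fun s : ℝ => z + s • x) x s := by
      simpa using ((hasDerivAt_id s).smul_const x).const_add z
    exact ((hg.differentiable one_ne_zero _).hasFDerivAt.comp_hasDerivAt s h1).const_smul _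

/-- The mean value property for radial weights. -/
lemma integral_radial_eq [CompleteSpace V] {η : ℝ → ℝ} (hη : Continuous η) {R : ℝ}
    (hR : ∀ s, R ≤ s → η s = 0) (hg : ContDiff ℝ 1 g) (z : EuclideanSpace ℝ (Fin m))
    (h : ∀ t : ℝ, t ≠ 0 → ∫ x, η (‖x‖ ^ 2) • fderiv ℝ g (z + t • x) x = 0) :
    ∫ x, η (‖x‖ ^ 2) • g (z + x) = (∫ x : EuclideanSpace ℝ (Fin m), η (‖x‖ ^ 2)) • g z := by
  -- At `t = 0` the integrand is odd in `x`. This value is treated separately because the monogenic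
  -- case divides by `t`.
  have h0 : ∫ x, η (‖x‖ ^ 2) • fderiv ℝ g z x = 0 := by
    have := integral_neg_eq_self (fun x => η (‖x‖ ^ 2) • fderiv ℝ g z x) volume
    simp only [norm_neg, map_neg, smul_neg, integral_neg] at this
    have h2 : (2 : ℝ) • ∫ x, η (‖x‖ ^ 2) • fderiv ℝ g z x = 0 := by
      rw [two_smul]
      nth_rewrite 1 [← this]
      exact neg_add_cancel _
    exact (smul_eq_zero.1 h2).resolve_left two_ne_zero
  have hd : ∀ t : ℝ, ∫ x, η (‖x‖ ^ 2) • fderiv ℝ g (z + t • x) x = 0 := fun t => by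
    by_cases ht : t = 0
    · simpa [ht] using h0
    · exact h t ht
  have hderiv := hasDerivAt_integral_radial hη hR hg z
  -- The dilation `t = 1` gives the average, `t = 0` the value at the centre.
  have hconst := is_const_of_deriv_eq_zero (fun t => (hderiv t).differentiableAt)
    (fun t => (hderiv t).deriv.trans (hd t)) 1 0
  simpa [integral_smul_const] using hconst

lemma sum_smul_single (x : EuclideanSpace ℝ (Fin m)) :
    ∑ j, x j • (EuclideanSpace.single j 1 : EuclideanSpace ℝ (Fin m)) = x := by
  ext i
  simp [Pi.single_apply]

lemma clm_apply_eq_sum (L : EuclideanSpace ℝ (Fin m) →L[ℝ] V) (x : EuclideanSpace ℝ (Fin m)) :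
    L x = ∑ j, x j • L (EuclideanSpace.single j 1) := by
  conv_lhs => rw [← sum_smul_single x]
  simp

lemma hasFDerivAt_comp_affine {G : EuclideanSpace ℝ (Fin m) → V} (hG : Differentiable ℝ G)
    (z : EuclideanSpace ℝ (Fin m)) (t : ℝ) (x : EuclideanSpace ℝ (Fin m)) :
    HasFDerivAt (fun x => G (z + t • x)) (t • fderiv ℝ G (z + t • x)) x := by
  have h1 : HasFDerivAt (fun x : EuclideanSpace ℝ (Fin m) => z + t • x)
      (t • ContinuousLinearMap.id ℝ _) x := ((hasFDerivAt_id x).const_smul t).const_add z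
  convert! (hG (z + t • x)).hasFDerivAt.comp x h1 using 1
  ext v
  simp

lemma hasFDerivAt_radial {H : ℝ → ℝ} {H' : ℝ} {x : EuclideanSpace ℝ (Fin m)}
    (hH : HasDerivAt H H' (‖x‖ ^ 2)) :
    HasFDerivAt (fun x : EuclideanSpace ℝ (Fin m) => H (‖x‖ ^ 2))
      (H' • (2 • (innerSL ℝ x))) x :=
  hH.comp_hasFDerivAt x (hasStrictFDerivAt_norm_sq x).hasFDerivAt

/-- The radial averages of a harmonic function do not depend on the radius. -/
lemma integral_radial_fderiv_of_harmonic (hg : ContDiff ℝ 2 g)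
    (hΔ : ∀ x, Laplacian.laplacian g x = 0)
    {η : ℝ → ℝ} (hη : Continuous η) {R : ℝ} (hR : ∀ s, R ≤ s → η s = 0)
    (z : EuclideanSpace ℝ (Fin m)) (t : ℝ) :
    ∫ x, η (‖x‖ ^ 2) • fderiv ℝ g (z + t • x) x = 0 := by
  -- `H` is chosen so that `H (‖x‖²)` has gradient `η (‖x‖²) x`. Starting the integral at `R` makes
  -- it compactly supported, so integrating by parts leaves only `-t ∫ H (‖x‖²) Δg`.
  let H : ℝ → ℝ := fun s => (1 / 2) * ∫ u in R..s, η u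
  have hH : ∀ s, HasDerivAt H ((1 / 2) * η s) s := fun s =>
    (hη.integral_hasStrictDerivAt R s).hasDerivAt.const_mul _
  have hHc : Continuous H := continuous_iff_continuousAt.2 fun s => (hH s).continuousAt
  have hHR : ∀ s, R ≤ s → H s = 0 := fun s hs => by
    simp only [H]
    rw [intervalIntegral.integral_congr (g := fun _ => 0)]
    · simp
    · intro u hu
      rw [Set.uIcc_of_le hs] at hu
      exact hR u hu.1
  have hfd : ContDiff ℝ 1 (fderiv ℝ g) := hg.fderiv_right (by norm_num)
  have hfc := hfd.continuous
  have hffc : Continuous (fderiv ℝ (fderiv ℝ g)) := hfd.continuous_fderiv one_ne_zero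
  have hψ : ∀ x : EuclideanSpace ℝ (Fin m), HasFDerivAt
      (fun x : EuclideanSpace ℝ (Fin m) => H (‖x‖ ^ 2))
      (((1 / 2) * η (‖x‖ ^ 2)) • (2 • (innerSL ℝ x))) x := fun x => hasFDerivAt_radial (hH _)
  have hψj : ∀ (x : EuclideanSpace ℝ (Fin m)) (j : Fin m),
      fderiv ℝ (fun x : EuclideanSpace ℝ (Fin m) => H (‖x‖ ^ 2)) x (EuclideanSpace.single j 1)
        = η (‖x‖ ^ 2) * x j := fun x j => by
    rw [(hψ x).fderiv]
    simp [EuclideanSpace.inner_single_right]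
    ring
  let gj : Fin m → EuclideanSpace ℝ (Fin m) → V := fun j x =>
    fderiv ℝ g (z + t • x) (EuclideanSpace.single j 1)
  have hgj : ∀ j x, HasFDerivAt (gj j)
      (t • (fderiv ℝ (fderiv ℝ g) (z + t • x)).flip (EuclideanSpace.single j 1)) x := fun j x => by
    have h1 := (hasFDerivAt_comp_affine (hfd.differentiable one_ne_zero) z t x).clm_apply
      (hasFDerivAt_const (EuclideanSpace.single j (1 : ℝ)) x)
    convert! h1 using 1
    ext v
    simp
  have hgjc : ∀ j, Continuous (gj j) := fun j =>
    continuous_iff_continuousAt.2 fun x => (hgj j x).continuousAt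
  have hcoord : ∀ j : Fin m, Continuous fun x : EuclideanSpace ℝ (Fin m) => x j :=
    fun j => by fun_prop
  have hI1 : ∀ j, Integrable (fun x => η (‖x‖ ^ 2) • (x j • gj j x)) volume := fun j =>
    integrable_radial_smul hη hR ((hcoord j).smul (hgjc j))
  have hsnd : ∀ j, Continuous fun x => (t • (fderiv ℝ (fderiv ℝ g) (z + t • x)).flip
      (EuclideanSpace.single j 1)) (EuclideanSpace.single j 1) := fun j => by
    simp only [_root_.smul_apply, ContinuousLinearMap.flip_apply]
    refine Continuous.const_smul ?_ t
    exact ((hffc.comp (by fun_prop)).clm_apply continuous_const).clm_apply continuous_const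
  have hI2 : ∀ j, Integrable (fun x => H (‖x‖ ^ 2) • (t • (fderiv ℝ (fderiv ℝ g) (z + t • x)).flip
      (EuclideanSpace.single j 1)) (EuclideanSpace.single j 1)) volume := fun j =>
    integrable_radial_smul hHc hHR (hsnd j)
  have hibp : ∀ j, ∫ x, H (‖x‖ ^ 2) • (t • (fderiv ℝ (fderiv ℝ g) (z + t • x)).flip
      (EuclideanSpace.single j 1)) (EuclideanSpace.single j 1)
        = -∫ x, η (‖x‖ ^ 2) • (x j • gj j x) := fun j => by
    have h := integral_smul_fderiv_eq_neg_fderiv_smul_of_integrable (𝕜 := ℝ) (μ := volume)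
      (f := fun x : EuclideanSpace ℝ (Fin m) => H (‖x‖ ^ 2)) (g := gj j)
      (v := EuclideanSpace.single j 1)
      (by simpa only [hψj, mul_smul] using hI1 j)
      (by simpa only [(hgj j _).fderiv] using hI2 j)
      (integrable_radial_smul hHc hHR (hgjc j))
      (fun x _ => (hψ x).differentiableAt) (fun x _ => (hgj j x).differentiableAt)
    simpa only [hψj, mul_smul, (hgj j _).fderiv] using h
  have hlap : ∀ x, ∑ j, (t • (fderiv ℝ (fderiv ℝ g) (z + t • x)).flip
      (EuclideanSpace.single j 1)) (EuclideanSpace.single j 1) = 0 := fun x => by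
    have h := hΔ (z + t • x)
    rw [InnerProductSpace.laplacian_eq_iteratedFDeriv_orthonormalBasis g
      (EuclideanSpace.basisFun (Fin m) ℝ)] at h
    simp only [iteratedFDeriv_two_apply, EuclideanSpace.basisFun_apply] at h
    simp only [_root_.smul_apply, ContinuousLinearMap.flip_apply,
      ← Finset.smul_sum]
    rw [show ∑ j, ((fderiv ℝ (fderiv ℝ g) (z + t • x)) (EuclideanSpace.single j 1))
      (EuclideanSpace.single j 1) = 0 from h, smul_zero]
  calc ∫ x, η (‖x‖ ^ 2) • fderiv ℝ g (z + t • x) x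
      = ∫ x, ∑ j, η (‖x‖ ^ 2) • (x j • gj j x) := by
        refine integral_congr_ae (Filter.Eventually.of_forall fun x => ?_)
        show η (‖x‖ ^ 2) • fderiv ℝ g (z + t • x) x = _
        rw [clm_apply_eq_sum, Finset.smul_sum]
    _ = ∑ j, ∫ x, η (‖x‖ ^ 2) • (x j • gj j x) := integral_finsetSum _ fun j _ => hI1 j
    _ = -∑ j, ∫ x, H (‖x‖ ^ 2) • (t • (fderiv ℝ (fderiv ℝ g) (z + t • x)).flip
          (EuclideanSpace.single j 1)) (EuclideanSpace.single j 1) := by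
        simp only [hibp, Finset.sum_neg_distrib, neg_neg]
    _ = 0 := by
        rw [← integral_finsetSum _ fun j _ => hI2 j]
        simp only [← Finset.smul_sum, hlap, smul_zero, integral_zero, neg_zero]

end MeanValue

/-! ### Radial mean values of monogenic functions -/

section Monogenic

variable {m : ℕ} {g : EuclideanSpace ℝ (Fin m) → ComplexClifford m}

/-- The radial averages of a monogenic function do not depend on the radius. -/
lemma integral_radial_fderiv_of_monogenic (hg : IsMonogenic g)
    {η : ℝ → ℝ} (hη : ContDiff ℝ 1 η) {R : ℝ} (hR : ∀ s, R ≤ s → η s = 0)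
    (z : EuclideanSpace ℝ (Fin m)) {t : ℝ} (ht : t ≠ 0) :
    ∫ x, η (‖x‖ ^ 2) • fderiv ℝ g (z + t • x) x = 0 := by
  have hηc := hη.continuous
  have hη'c : Continuous (deriv η) := hη.continuous_deriv_one
  have hη'R : ∀ s, R + 1 ≤ s → deriv η s = 0 := fun s hs => by
    have : η =ᶠ[nhds s] fun _ => 0 := by
      filter_upwards [lt_mem_nhds (by linarith : R < s)] with u hu
      exact hR u hu.le
    rw [this.deriv_eq]
    simp
  have hgc := hg.1.continuous
  have hg1 : Continuous (fderiv ℝ g) := hg.1.continuous_fderiv one_ne_zero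
  have hg1' : ∀ k, Continuous fun x =>
      fderiv ℝ g (z + t • x) (EuclideanSpace.single k 1) := fun k =>
    (hg1.comp (by fun_prop)).clm_apply continuous_const
  let I : Fin m → Fin m → ComplexClifford m := fun j k =>
    ∫ x, η (‖x‖ ^ 2) • (x j • fderiv ℝ g (z + t • x) (EuclideanSpace.single k 1))
  have hcoord : ∀ j : Fin m, Continuous fun x : EuclideanSpace ℝ (Fin m) => x j :=
    fun j => by fun_prop
  have hI : ∀ j k, Integrable (fun x => η (‖x‖ ^ 2) •
      (x j • fderiv ℝ g (z + t • x) (EuclideanSpace.single k 1))) volume := fun j k =>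
    integrable_radial_smul hηc hR ((hcoord j).smul (hg1' k))
  -- Move `∂_k` onto `η (‖x‖²) x_j`: for `j ≠ k` the result `2 η' x_j x_k` is symmetric in `j` and
  -- `k`. The factor `t` comes from the chain rule.
  have hsymm : ∀ j k, j ≠ k → t • I j k
      = -∫ x, (2 * deriv η (‖x‖ ^ 2) * x j * x k) • g (z + t • x) := fun j k hjk => by
    have hf : ∀ x : EuclideanSpace ℝ (Fin m), HasFDerivAt
        (fun x : EuclideanSpace ℝ (Fin m) => η (‖x‖ ^ 2) * x j)
        (η (‖x‖ ^ 2) • (EuclideanSpace.proj j : EuclideanSpace ℝ (Fin m) →L[ℝ] ℝ) +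
          x j • (deriv η (‖x‖ ^ 2) • (2 • (innerSL ℝ x)))) x := fun x =>
      (hasFDerivAt_radial (hη.differentiable one_ne_zero _).hasDerivAt).mul
        (EuclideanSpace.proj j : EuclideanSpace ℝ (Fin m) →L[ℝ] ℝ).hasFDerivAt
    have hf' : ∀ x : EuclideanSpace ℝ (Fin m),
        fderiv ℝ (fun x : EuclideanSpace ℝ (Fin m) => η (‖x‖ ^ 2) * x j) x
          (EuclideanSpace.single k 1) = 2 * deriv η (‖x‖ ^ 2) * x j * x k := fun x => by
      rw [(hf x).fderiv]
      simp [EuclideanSpace.inner_single_right, hjk]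
      ring
    have hgt := fun x => hasFDerivAt_comp_affine (hg.1.differentiable one_ne_zero) z t x
    have h := integral_smul_fderiv_eq_neg_fderiv_smul_of_integrable (𝕜 := ℝ) (μ := volume)
      (f := fun x : EuclideanSpace ℝ (Fin m) => η (‖x‖ ^ 2) * x j)
      (g := fun x => g (z + t • x)) (v := EuclideanSpace.single k 1) ?_ ?_ ?_
      (fun x _ => (hf x).differentiableAt) (fun x _ => (hgt x).differentiableAt)
    · simp only [hf', (hgt _).fderiv, _root_.smul_apply] at h
      rw [← h]
      simp only [I, ← integral_smul]
      refine integral_congr_ae (Filter.Eventually.of_forall fun x => ?_)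
      simp only [smul_smul]
      congr 1
      ring
    · simp only [hf']
      have := integrable_radial_smul hη'c hη'R
        (F := fun x : EuclideanSpace ℝ (Fin m) => (2 * x j * x k) • g (z + t • x)) (by fun_prop)
      refine this.congr (Filter.Eventually.of_forall fun x => ?_)
      simp only [smul_smul]
      congr 1
      ring
    · simp only [(hgt _).fderiv, _root_.smul_apply]
      refine ((hI j k).smul t).congr (Filter.Eventually.of_forall fun x => ?_)
      simp only [Pi.smul_apply, smul_smul]
      congr 1
      ring
    · have := integrable_radial_smul hηc hR
        (F := fun x : EuclideanSpace ℝ (Fin m) => x j • g (z + t • x)) (by fun_prop)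
      simpa only [mul_smul] using this
  have hsymm' : ∀ j k, j ≠ k → I j k = I k j := fun j k hjk => by
    refine smul_right_injective _ ht ?_
    show t • I j k = t • I k j
    rw [hsymm j k hjk, hsymm k j hjk.symm]
    congr 1
    refine integral_congr_ae (Filter.Eventually.of_forall fun x => ?_)
    show _ • _ = _ • _
    congr 1
    ring
  -- The inner sum over `k` contains the Dirac operator applied to `g` and vanishes. By the symmetry
  -- of `I`, the same double sum is `-∑ I j j`, and `∑ I j j` is the integral in question.
  have hsum : ∑ j, ∑ k, e j * (e k * I j k) = 0 := by
    refine Finset.sum_eq_zero fun j _ => ?_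
    rw [← Finset.mul_sum]
    have h1 : ∀ k, e k * I j k = ∫ x, η (‖x‖ ^ 2) •
        (x j • (e k * fderiv ℝ g (z + t • x) (EuclideanSpace.single k 1))) := fun k => by
      have h2 := ((mulCLM (e k)).restrictScalars ℝ).integral_comp_comm (hI j k)
      simpa only [ContinuousLinearMap.coe_restrictScalars', mulCLM_apply, mul_smul_comm] using
        h2.symm
    have h3 : ∀ k, Integrable (fun x => η (‖x‖ ^ 2) •
        (x j • (e k * fderiv ℝ g (z + t • x) (EuclideanSpace.single k 1)))) volume := fun k =>
      integrable_radial_smul hηc hR ((hcoord j).smul ((mulCLM (e k)).continuous.comp (hg1' k)))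
    simp only [h1]
    rw [← integral_finsetSum _ fun k _ => h3 k]
    have h4 : ∀ x, ∑ k, e k * fderiv ℝ g (z + t • x) (EuclideanSpace.single k 1) = 0 :=
      fun x => hg.2 (z + t • x)
    simp only [← Finset.smul_sum, h4, smul_zero, integral_zero, mul_zero]
  rw [sum_e_mul_e_mul_of_symm I hsymm', neg_eq_zero] at hsum
  rw [← hsum, ← integral_finsetSum _ fun j _ => hI j j]
  refine integral_congr_ae (Filter.Eventually.of_forall fun x => ?_)
  show η (‖x‖ ^ 2) • fderiv ℝ g (z + t • x) x = _
  rw [clm_apply_eq_sum, Finset.smul_sum]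

end Monogenic

/-! ### Passage from compactly supported weights to the Gaussian -/

section GaussianMean

variable {m : ℕ} {V : Type*} [NormedAddCommGroup V] [NormedSpace ℝ V] [CompleteSpace V]
  {g : EuclideanSpace ℝ (Fin m) → V}

/-- A function whose radial averages do not depend on the radius is a fixed point of the heat
semigroup. -/
lemma integral_gaussian_smul_eq (hg : ContDiff ℝ 1 g) (z : EuclideanSpace ℝ (Fin m))
    (h : ∀ (η : ℝ → ℝ) (R : ℝ), ContDiff ℝ 1 η → (∀ s, R ≤ s → η s = 0) → ∀ t : ℝ, t ≠ 0 →
      ∫ x, η (‖x‖ ^ 2) • fderiv ℝ g (z + t • x) x = 0)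
    (hint : Integrable (fun x => Real.exp (-‖x‖ ^ 2 / 2) • g (z + x)) volume)
    (hint1 : Integrable (fun x : EuclideanSpace ℝ (Fin m) => Real.exp (-‖x‖ ^ 2 / 2)) volume) :
    ∫ x, Real.exp (-‖x‖ ^ 2 / 2) • g (z + x)
      = (∫ x : EuclideanSpace ℝ (Fin m), Real.exp (-‖x‖ ^ 2 / 2)) • g z := by
  -- `η n` equals the Gaussian weight for `s ≤ n`, vanishes for `s ≥ n + 1` and is dominated by it
  -- throughout.
  let η : ℕ → ℝ → ℝ := fun n s => Real.exp (-s / 2) * Real.smoothTransition (n + 1 - s)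
  have hη : ∀ n, ContDiff ℝ 1 (η n) := fun n => by
    have h1 : ContDiff ℝ 1 Real.smoothTransition := Real.smoothTransition.contDiff (n := 1)
    exact ContDiff.mul (by fun_prop) (h1.comp (by fun_prop))
  have hηc := fun n => (hη n).continuous
  have hR : ∀ (n : ℕ) (s : ℝ), (n : ℝ) + 1 ≤ s → η n s = 0 := fun n s hs => by
    simp only [η]
    rw [Real.smoothTransition.zero_of_nonpos (by linarith), mul_zero]
  have hle : ∀ n s, |η n s| ≤ Real.exp (-s / 2) := fun n s => by
    simp only [η]
    rw [abs_mul, Real.abs_exp, abs_of_nonneg (Real.smoothTransition.nonneg _)]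
    exact mul_le_of_le_one_right (Real.exp_pos _).le (Real.smoothTransition.le_one _)
  have hev : ∀ s : ℝ, ∀ᶠ n in Filter.atTop, η n s = Real.exp (-s / 2) := fun s => by
    obtain ⟨N, hN⟩ := exists_nat_ge s
    filter_upwards [Filter.eventually_ge_atTop N] with n hn
    have : (N : ℝ) ≤ n := by exact_mod_cast hn
    simp only [η]
    rw [Real.smoothTransition.one_of_one_le (by linarith), mul_one]
  have hgc := hg.continuous
  have h1 := tendsto_integral_of_dominated_convergence (μ := volume)
    (F := fun n x => η n (‖x‖ ^ 2) • g (z + x)) (f := fun x => Real.exp (-‖x‖ ^ 2 / 2) • g (z + x))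
    _ (fun n => (by have := hηc n; fun_prop : Continuous fun x =>
      η n (‖x‖ ^ 2) • g (z + x)).aestronglyMeasurable) hint.norm
    (fun n => Filter.Eventually.of_forall fun x => by
      rw [norm_smul, norm_smul, Real.norm_eq_abs, Real.norm_eq_abs, Real.abs_exp]
      exact mul_le_mul_of_nonneg_right (hle n _) (norm_nonneg _))
    (Filter.Eventually.of_forall fun x => tendsto_const_nhds.congr' (by
      filter_upwards [hev (‖x‖ ^ 2)] with n hn
      rw [hn]))
  have h2 := tendsto_integral_of_dominated_convergence (μ := volume)
    (F := fun n (x : EuclideanSpace ℝ (Fin m)) => η n (‖x‖ ^ 2))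
    (f := fun x => Real.exp (-‖x‖ ^ 2 / 2))
    _ (fun n => (by have := hηc n; fun_prop : Continuous fun x : EuclideanSpace ℝ (Fin m) =>
      η n (‖x‖ ^ 2)).aestronglyMeasurable) hint1
    (fun n => Filter.Eventually.of_forall fun x => hle n _)
    (Filter.Eventually.of_forall fun x => tendsto_const_nhds.congr' (by
      filter_upwards [hev (‖x‖ ^ 2)] with n hn
      rw [hn]))
  refine tendsto_nhds_unique h1 ?_
  simp only [fun n => integral_radial_eq (hηc n) (hR n) hg z (h _ _ (hη n) (hR n))]
  exact h2.smul_const (g z)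

end GaussianMean
end

noncomputable section

open Finset ComplexClifford

/-! ### The Segal–Bargmann transform as an entire power series -/

section SegalBargmann

variable {m : ℕ} {f g : EuclideanSpace ℝ (Fin m) → ComplexClifford m}

lemma sum_abs_le_mul_norm (x : EuclideanSpace ℝ (Fin m)) : ∑ j, |x j| ≤ m * ‖x‖ := by
  refine (Finset.sum_le_sum fun j _ => PiLp.norm_apply_le x j).trans_eq ?_
  simp

lemma integrable_exp_neg_mul_norm_sq (m : ℕ) {b : ℝ} (hb : 0 < b) :
    Integrable (fun x : EuclideanSpace ℝ (Fin m) => Real.exp (-b * ‖x‖ ^ 2)) volume := by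
  have h := GaussianFourier.integrable_cexp_neg_mul_sq_norm_add (b := (b : ℂ)) (by simpa) 0
    (0 : EuclideanSpace ℝ (Fin m))
  refine h.norm.congr (Filter.Eventually.of_forall fun x => ?_)
  simp only [Complex.norm_exp]
  congr 1
  rw [zero_mul, add_zero]
  norm_cast

lemma memLp_exp_sub_norm_sq (m : ℕ) (r : ℝ) :
    MemLp (fun x : EuclideanSpace ℝ (Fin m) => Real.exp (r * ∑ j, |x j| - ‖x‖ ^ 2 / 4)) 2
      volume := by
  have hcont : Continuous fun x : EuclideanSpace ℝ (Fin m) =>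
      Real.exp (r * ∑ j, |x j| - ‖x‖ ^ 2 / 4) := by fun_prop
  rw [memLp_two_iff_integrable_sq hcont.aestronglyMeasurable]
  -- Half of the decay `-‖x‖² / 2` of the square is kept; the rest absorbs the linear term by `2 a
  -- ‖x‖ ≤ ‖x‖² / 4 + 4 a²` with `a = |r| m`.
  refine ((integrable_exp_neg_mul_norm_sq m (b := 1 / 4) (by norm_num)).const_mul
    (Real.exp (4 * (|r| * m) ^ 2))).mono' (hcont.pow 2).aestronglyMeasurable
    (Filter.Eventually.of_forall fun x => ?_)
  rw [Real.norm_of_nonneg (by positivity), ← Real.exp_nat_mul, ← Real.exp_add]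
  refine Real.exp_le_exp.2 ?_
  have h1 : r * ∑ j, |x j| ≤ |r| * (m * ‖x‖) :=
    (mul_le_mul_of_nonneg_right (le_abs_self r) (sum_nonneg fun j _ => abs_nonneg _)).trans
      (mul_le_mul_of_nonneg_left (sum_abs_le_mul_norm x) (abs_nonneg r))
  push_cast
  nlinarith [sq_nonneg (‖x‖ / 2 - 2 * (|r| * m))]

variable (hfg : ∀ x, f x = Real.exp (-‖x‖ ^ 2 / 4) • g x) (hf : MemLp f 2 volume)

include hfg in
lemma exp_smul_eq (x : EuclideanSpace ℝ (Fin m)) :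
    Real.exp (-‖x‖ ^ 2 / 2) • g x = Real.exp (-‖x‖ ^ 2 / 4) • f x := by
  rw [hfg, smul_smul, ← Real.exp_add]
  congr 2
  ring

include hfg hf in
-- One factor `e^{-|x|²/4}` goes into `f`. The other, multiplied by the exponential, is still in
-- `L²`, so the product of the two is integrable.
lemma hasExpDecay_gaussian_smul (κ : ℝ) :
    HasExpDecay fun x => κ • Real.exp (-‖x‖ ^ 2 / 2) • g x := by
  simp only [exp_smul_eq hfg]
  refine ⟨((by fun_prop : Continuous fun x : EuclideanSpace ℝ (Fin m) =>
    Real.exp (-‖x‖ ^ 2 / 4)).aestronglyMeasurable.smul hf.1).const_smul κ, fun r _ => ?_⟩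
  have h := (MemLp.integrable_mul (memLp_exp_sub_norm_sq m r) hf.norm).const_mul |κ|
  refine h.congr (Filter.Eventually.of_forall fun x => ?_)
  simp only [Pi.mul_apply, norm_smul, Real.norm_eq_abs, Real.abs_exp]
  rw [sub_eq_add_neg, Real.exp_add, neg_div]
  ring

lemma cdot_realToComplex_self (x : EuclideanSpace ℝ (Fin m)) :
    cdot (realToComplex x) (realToComplex x) = ((‖x‖ ^ 2 : ℝ) : ℂ) := by
  rw [EuclideanSpace.norm_sq_eq, cdot]
  push_cast
  refine Finset.sum_congr rfl fun j _ => ?_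
  simp only [realToComplex, Real.norm_eq_abs]
  rw [← Complex.ofReal_pow, sq_abs, sq, Complex.ofReal_mul]

lemma cdot_comm (z w : EuclideanSpace ℂ (Fin m)) : cdot z w = cdot w z :=
  Finset.sum_congr rfl fun _ _ => mul_comm _ _

include hfg in
lemma segalBargmannIntegrand_eq (z : EuclideanSpace ℂ (Fin m)) (x : EuclideanSpace ℝ (Fin m)) :
    segalBargmannIntegrand f z x = Complex.exp (-cdot z z / 2) •
      Complex.exp (cdot z (realToComplex x)) • Real.exp (-‖x‖ ^ 2 / 2) • g x := by
  rw [segalBargmannIntegrand, exp_smul_eq hfg, ← Complex.coe_smul, smul_smul, smul_smul,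
    Complex.ofReal_exp, ← Complex.exp_add, ← Complex.exp_add, cdot_realToComplex_self,
    cdot_comm (realToComplex x)]
  congr 2
  push_cast
  ring

lemma HasExpDecay.integrable_cexp_smul {w : EuclideanSpace ℝ (Fin m) → ComplexClifford m}
    (hw : HasExpDecay w) (z : EuclideanSpace ℂ (Fin m)) :
    Integrable (fun x => Complex.exp (cdot z (realToComplex x)) • w x) volume := by
  refine (hw.2 ‖z‖ (norm_nonneg z)).mono' ?_ (Filter.Eventually.of_forall fun x => ?_)
  · have hcont : Continuous fun x : EuclideanSpace ℝ (Fin m) =>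
        Complex.exp (cdot z (realToComplex x)) := by
      simp only [cdot, realToComplex]
      fun_prop
    exact hcont.aestronglyMeasurable.smul hw.1
  · rw [norm_smul, Complex.norm_exp]
    refine mul_le_mul_of_nonneg_right (Real.exp_le_exp.2 ((Complex.re_le_norm _).trans ?_))
      (norm_nonneg _)
    rw [cdot, Finset.mul_sum]
    refine (norm_sum_le _ _).trans (Finset.sum_le_sum fun j _ => ?_)
    rw [norm_mul]
    refine mul_le_mul (PiLp.norm_apply_le z j) (by simp [realToComplex]) (norm_nonneg _)
      (norm_nonneg _)

include hfg hf in
lemma integrable_segalBargmannIntegrand (z : EuclideanSpace ℂ (Fin m)) :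
    Integrable (segalBargmannIntegrand f z) volume := by
  have hw := hasExpDecay_gaussian_smul hfg hf 1
  simp only [one_smul] at hw
  exact ((hw.integrable_cexp_smul z).smul (Complex.exp (-cdot z z / 2))).congr
    (Filter.Eventually.of_forall fun x => (segalBargmannIntegrand_eq hfg z x).symm)

/-- The normalizing constant `(2π)^{-m/2}`. -/
def gaussianConst (m : ℕ) : ℝ := (2 * Real.pi) ^ (-(m : ℝ) / 2)

/-- The Taylor coefficients of the Segal-Bargmann transform of `g(x) e^{-|x|²/4}`. -/
def segalBargmannCoeff (g : EuclideanSpace ℝ (Fin m) → ComplexClifford m) :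
    (Fin m → ℕ) → ComplexClifford m :=
  gaussianCoeff (moment fun x => gaussianConst m • Real.exp (-‖x‖ ^ 2 / 2) • g x)

include hfg hf in
lemma entireCoeff_segalBargmannCoeff : EntireCoeff (segalBargmannCoeff g) :=
  (hasExpDecay_gaussian_smul hfg hf _).entireCoeff_moment.gaussianCoeff

include hfg hf in
lemma segalBargmann_eq : segalBargmann f = evalSeries (segalBargmannCoeff g) := funext fun z => by
  have hw := hasExpDecay_gaussian_smul hfg hf (gaussianConst m)
  rw [segalBargmannCoeff, hw.entireCoeff_moment.evalSeries_gaussianCoeff, hw.evalSeries_moment,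
    segalBargmann, ← integral_smul, ← integral_smul]
  refine integral_congr_ae (Filter.Eventually.of_forall fun x => ?_)
  show gaussianConst m • segalBargmannIntegrand f z x = _
  rw [segalBargmannIntegrand_eq hfg, smul_comm (gaussianConst m), smul_comm (gaussianConst m)]

include hfg hf in
lemma hasMonogenicPart_segalBargmann :
    HasMonogenicPart (segalBargmann f)
      (fun z => ∑' α, monogenicMonomial α z * segalBargmannCoeff g α) := by
  rw [segalBargmann_eq hfg hf]
  exact (entireCoeff_segalBargmannCoeff hfg hf).hasMonogenicPart

include hfg hf in
lemma tsum_monogenicMonomial_segalBargmannCoeff (z : EuclideanSpace ℂ (Fin m)) :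
    ∑' α, monogenicMonomial α z * segalBargmannCoeff g α = gaussianConst m •
      ∫ x, fourierBorelKernel z x * (Real.exp (-‖x‖ ^ 2 / 2) • g x) := by
  have hw := hasExpDecay_gaussian_smul hfg hf (gaussianConst m)
  rw [segalBargmannCoeff, hw.entireCoeff_moment.tsum_monogenicMonomial_gaussianCoeff,
    hw.tsum_monogenicMonomial_moment, ← integral_smul]
  simp only [mul_smul_comm]

lemma gaussianConst_mul_integral (m : ℕ) : gaussianConst m *
    ∫ x : EuclideanSpace ℝ (Fin m), Real.exp (-‖x‖ ^ 2 / 2) = 1 := by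
  have h := GaussianFourier.integral_rexp_neg_mul_sq_norm (V := EuclideanSpace ℝ (Fin m))
    (b := 1 / 2) (by norm_num)
  have h1 : ∀ x : EuclideanSpace ℝ (Fin m), -‖x‖ ^ 2 / 2 = -(1 / 2) * ‖x‖ ^ 2 := fun x => by ring
  simp only [h1, h, finrank_euclideanSpace_fin]
  rw [gaussianConst, show Real.pi / (1 / 2) = 2 * Real.pi by ring,
    ← Real.rpow_add (by positivity)]
  simp [neg_div]

include hfg hf in
/-- The Segal-Bargmann transform extends functions whose radial averages do not depend on the
radius. -/
lemma segalBargmann_realToComplex (hg : ContDiff ℝ 1 g)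
    (h : ∀ (η : ℝ → ℝ) (R : ℝ), ContDiff ℝ 1 η → (∀ s, R ≤ s → η s = 0) →
      ∀ (z : EuclideanSpace ℝ (Fin m)) (t : ℝ), t ≠ 0 →
        ∫ x, η (‖x‖ ^ 2) • fderiv ℝ g (z + t • x) x = 0)
    (z : EuclideanSpace ℝ (Fin m)) : segalBargmann f (realToComplex z) = g z := by
  -- Completing the square: at a real point the integrand is `g` times the Gaussian centred there.
  have heq : ∀ x, segalBargmannIntegrand f (realToComplex z) x
      = Real.exp (-‖x - z‖ ^ 2 / 2) • g x := fun x => by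
    rw [segalBargmannIntegrand_eq hfg, ← Complex.coe_smul, ← Complex.coe_smul, smul_smul,
      smul_smul, Complex.ofReal_exp, Complex.ofReal_exp, ← Complex.exp_add, ← Complex.exp_add,
      cdot_realToComplex_self]
    congr 2
    have h1 : cdot (realToComplex z) (realToComplex x) = ((inner ℝ x z : ℝ) : ℂ) := by
      simp [cdot, realToComplex, PiLp.inner_apply]
    rw [h1, norm_sub_sq_real]
    push_cast
    ring
  have hint : Integrable (fun x => Real.exp (-‖x‖ ^ 2 / 2) • g (z + x)) volume := by
    have h1 := (integrable_segalBargmannIntegrand hfg hf (realToComplex z)).comp_add_left z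
    simpa only [heq, add_sub_cancel_left] using h1
  have hint1 : Integrable (fun x : EuclideanSpace ℝ (Fin m) => Real.exp (-‖x‖ ^ 2 / 2))
      volume := by
    refine (integrable_exp_neg_mul_norm_sq m (b := 1 / 2) (by norm_num)).congr
      (Filter.Eventually.of_forall fun x => ?_)
    show Real.exp _ = Real.exp _
    congr 1
    ring
  have hmean := integral_gaussian_smul_eq hg z (fun η R h1 h2 => h η R h1 h2 z) hint hint1
  rw [segalBargmann, ← integral_add_left_eq_self _ z]
  simp only [heq, add_sub_cancel_left]
  rw [hmean, smul_smul]
  show (gaussianConst m * _) • g z = g z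
  rw [gaussianConst_mul_integral, one_smul]

end SegalBargmann

/-! ### Harmonic and monogenic `g`, and the Fischer inner product -/

section Proposition

variable {m : ℕ} {f g : EuclideanSpace ℝ (Fin m) → ComplexClifford m}
  (hfg : ∀ x, f x = Real.exp (-‖x‖ ^ 2 / 4) • g x) (hf : MemLp f 2 volume)

include hfg hf in
lemma segalBargmann_of_harmonic (hg : InnerProductSpace.HarmonicOnNhd g Set.univ)
    (x : EuclideanSpace ℝ (Fin m)) : segalBargmann f (realToComplex x) = g x := by
  have hC : ContDiff ℝ 2 g := contDiff_iff_contDiffAt.2 fun x => (hg x trivial).1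
  exact segalBargmann_realToComplex hfg hf (hC.of_le (by norm_num))
    (fun η R h1 h2 z t _ => integral_radial_fderiv_of_harmonic hC
      (fun x => (hg x trivial).2.self_of_nhds) h1.continuous h2 z t) x

include hfg hf in
lemma segalBargmann_of_monogenic (hg : IsMonogenic g)
    (x : EuclideanSpace ℝ (Fin m)) : segalBargmann f (realToComplex x) = g x :=
  segalBargmann_realToComplex hfg hf hg.1
    (fun _ _ h1 h2 z _ ht => integral_radial_fderiv_of_monogenic hg h1 h2 z ht) x

/-- The factorials cancel: `E(z, ·)†` has Taylor coefficients `(M_α(z) / α!)†`, while `∂^α` of the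
second function at `0` is `α! b α`. The Fischer series is thus `∑ M_α(z) b α`. -/
lemma hasFischerInner_kernel {b : (Fin m → ℕ) → ComplexClifford m} (hb : EntireCoeff b)
    (z : EuclideanSpace ℂ (Fin m)) :
    HasFischerInner (fun x => star (fourierBorelKernel z x))
      (fun x => evalSeries b (realToComplex x)) (∑' α, monogenicMonomial α z * b α) := by
  have hk := entireCoeff_kernelCoeff z
  have hstar : EntireCoeff fun α => star (kernelCoeff z α) := fun r hr => by
    refine Summable.of_nonneg_of_le (fun α => by positivity) (fun α => ?_)
      ((hk r hr).mul_left ‖starCLM m‖)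
    have := mul_le_mul_of_nonneg_left ((starCLM m).le_opNorm (kernelCoeff z α))
      (pow_nonneg hr (∑ j, α j))
    rw [starCLM_apply] at this
    linarith
  have heq : (fun x => star (fourierBorelKernel z x))
      = fun x => evalSeries (fun α => star (kernelCoeff z α)) (realToComplex x) := by
    funext x
    rw [fourierBorelKernel_eq]
    have h1 := (starCLM m).hasSum (hk.hasSum (realToComplex x))
    refine h1.unique ?_
    convert! hstar.hasSum (realToComplex x) using 2 with α
    -- `star` is conjugate linear, so it commutes with the monomials only because they are real at
    -- real points.
    have : ∃ r : ℝ, monom (realToComplex x) α = r :=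
      ⟨∏ j, x j ^ α j, by simp [monom, realToComplex]⟩
    obtain ⟨r, hr⟩ := this
    rw [hr, Complex.coe_smul, map_smul, Complex.coe_smul, starCLM_apply]
  refine ⟨heq ▸ hstar.analyticOnNhd_real, hb.analyticOnNhd_real, ?_⟩
  convert! (hb.summable_monogenicMonomial_mul z).hasSum using 2 with α
  rw [heq, taylorCoeff_evalSeries hstar, multiDeriv_evalSeries hb, star_star, kernelCoeff,
    smul_mul_smul_comm]
  push_cast
  rw [inv_mul_cancel₀ (prod_factorial_ne_zero α), one_smul]

end Proposition

end

theorem proposition4p6 (m : ℕ) (g f : EuclideanSpace ℝ (Fin m) → ComplexClifford m)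
    (hfg : ∀ x, f x = Real.exp (-‖x‖ ^ 2 / 4) • g x)
    (hf : MemLp f 2 volume) :
    -- `E(·, u)` is the monogenic part of `e^{⟨·, u⟩}`, and `𝓑[f]` exists and has a monogenic part
    (∀ u : EuclideanSpace ℝ (Fin m),
      HasMonogenicPart (expPairing u) (fun z => fourierBorelKernel z u)) ∧
    (∀ z, Integrable (segalBargmannIntegrand f z) volume) ∧
    HasMonogenicPart (segalBargmann f) (monogenicPart (segalBargmann f)) ∧
    -- the integral formula
    (∀ z, Integrable (fun x => fourierBorelKernel z x * (Real.exp (-‖x‖ ^ 2 / 2) • g x)) volume) ∧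
    (∀ z, monogenicPart (segalBargmann f) z =
      ((2 * Real.pi) ^ (-(m : ℝ) / 2) : ℝ) •
        ∫ x, fourierBorelKernel z x * (Real.exp (-‖x‖ ^ 2 / 2) • g x)) ∧
    -- the Fischer inner product `[E(z, ·)†, g]`
    (InnerProductSpace.HarmonicOnNhd g Set.univ →
      ∀ z, HasFischerInner (fun x => star (fourierBorelKernel z x)) g
        (((2 * Real.pi) ^ (-(m : ℝ) / 2) : ℝ) •
          ∫ x, fourierBorelKernel z x * (Real.exp (-‖x‖ ^ 2 / 2) • g x))) ∧
    -- the monogenic part is `g(z)`, the holomorphic extension of `g`, if `g` is monogenic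
    (IsMonogenic g →
      ∃ G : EuclideanSpace ℂ (Fin m) → ComplexClifford m,
        Differentiable ℂ G ∧ (∀ x, G (realToComplex x) = g x) ∧
          ∀ z, monogenicPart (segalBargmann f) z = G z) := by
  have hM := hasMonogenicPart_segalBargmann hfg hf
  have hb := entireCoeff_segalBargmannCoeff hfg hf
  have hB := segalBargmann_eq hfg hf
  refine ⟨fun u => ?_, integrable_segalBargmannIntegrand hfg hf, ?_, fun z => ?_, fun z => ?_,
    fun hg z => ?_, fun hg => ?_⟩
  · simpa only [fourierBorelKernel_eq] using hasMonogenicPart_expPairing u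
  · rw [hM.monogenicPart_eq]
    exact hM
  · have hw := hasExpDecay_gaussian_smul hfg hf 1
    simp only [one_smul] at hw
    exact hw.integrable_kernel z
  · rw [hM.monogenicPart_eq]
    exact tsum_monogenicMonomial_segalBargmannCoeff hfg hf z
  · have h := hasFischerInner_kernel hb z
    rw [tsum_monogenicMonomial_segalBargmannCoeff hfg hf z] at h
    -- The mean value property makes `g` itself the restriction of an entire series; this also
    -- provides its analyticity.
    have hgeq : g = fun x => evalSeries (segalBargmannCoeff g) (realToComplex x) :=
      funext fun x => by rw [← hB, segalBargmann_of_harmonic hfg hf hg]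
    rw [← hgeq] at h
    exact h
  · have hext := segalBargmann_of_monogenic hfg hf hg
    refine ⟨segalBargmann f, hM.1, hext, fun z => ?_⟩
    have hgeq : (fun x => evalSeries (segalBargmannCoeff g) (realToComplex x)) = g :=
      funext fun x => by rw [← hB, hext]
    -- `∂_x̲ g = 0` says that the series of `∂_z̲ 𝓑[f]` vanishes on `ℝ^m`, and real values determine
    -- the coefficients.
    have hd : diracCoeff (segalBargmannCoeff g) = 0 := by
      refine hb.diracCoeff.ext_real (d := 0) (fun r _ => by simp) fun x => ?_
      rw [← hb.dirac_real_evalSeries, hgeq, hg.2]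
      simp [evalSeries]
    have hself := hb.hasMonogenicPart_self hd
    rw [hB, hself.monogenicPart_eq]
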